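/- Let $\mathbb T^N=\mathbb R^N/\mathbb Z^N$ and let $H_1,\dots,H_M:\mathbb T^N\times\mathbb R^N\to\mathbb R$ be continuous, and convex and superlinear in the second variable $p$, i.e. $H_i(x,p)/|p|\to+\infty$ as $|p|\to\infty$. Put $L_i(x,q)=\max_{p\in\mathbb R^N}\big(p\cdot q-H_i(x,p)\big)$. Let $\Lambda$ be a real $M\times M$ matrix with nonpositive off-diagonal entries and all row sums $0$, which is irreducible: for every nonempty $I\subsetneq\{1,\dots,M\}$ there are $i\in I$, $j\notin I$ with $\Lambda_{ij}\neq0$. For $\alpha\in\mathbb R$ consider the system $$H_i(x,Du_i)+\sum_{j}\Lambda_{ij}u_j=\alpha\quad\text{on }\mathbb T^N,\qquad i=1,\dots,M.\tag{HJ$\alpha$}$$ A subsolution is a continuous $\mathbf u=(u_1,\dots,u_M):\mathbb T^N\to\mathbb R^M$ such that $H_i(x,D\psi(x))+\sum_j\Lambda_{ij}u_j(x)\le\alpha$ whenever $\psi\in C^1(\mathbb T^N)$ and $u_i-\psi$ attains its maximum at $x$. Let $\gamma$ be the infimum of the $\alpha\in\mathbb R$ for which (HJ$\alpha$) has a subsolution.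 Let $\mathcal D$ be the space of cadlag paths $\omega:[0,\infty)\to\{1,\dots,M\}$, with the $\sigma$-algebra $\mathcal F$ generated by all evaluations and the filtration $\mathcal F_t$ generated by the evaluations at times $s\le t$. For a probability vector $\mathbf a\in\mathbb R^M$ let $\mathbb P_{\mathbf a}$, with expectation $\mathbb E_{\mathbf a}$, be the probability measure on $(\mathcal D,\mathcal F)$ determined by $$\mathbb P_{\mathbf a}\big(\omega(t_1)=j_1,\dots,\omega(t_k)=j_k\big)=\big(\mathbf a\,e^{-t_1\Lambda}\big)_{j_1}\prod_{l=2}^k\big(e^{-(t_l-t_{l-1})\Lambda}\big)_{j_{l-1}j_l},\qquad 0\le t_1<\dots<t_k.$$ A bounded stopping time is a bounded $\tau:\mathcal D\to[0,\infty)$ with $\{\tau\le t\}\in\mathcal F_t$ for all $t\ge0$. A control is a measurable map $\Xi$ from $\mathcal D$ to the space of cadlag paths $[0,\infty)\to\mathbb R^N$ (with the $\sigma$-algebra generated by the evaluations) such that for every $t>0$ there is $R>0$ with $\sup_{[0,t]}|\Xi|<R$ $\mathbb P_{\mathbf a}$-almost surely, and such that for every $t>0$, $\omega_1=\omega_2$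 on $[0,t]$ implies $\Xi(\omega_1)=\Xi(\omega_2)$ on $[0,t]$. For such a path $\xi$ let $\mathcal I(\xi)(t)\in\mathbb T^N$ be the class of $\int_0^t\xi\,ds$ modulo $\mathbb Z^N$. **Theorem.** Let $\alpha\ge\gamma$, let $\mathbf u$ be a subsolution of (HJ$\alpha$), $\mathbf a$ a probability vector, $\tau$ a bounded stopping time and $\Xi$ a control. Then for every $x\in\mathbb T^N$ all the integrals below exist and are finite, and $$\mathbb E_{\mathbf a}\big[u_{\omega(0)}(x)-u_{\omega(\tau)}\big(x+\mathcal I(\Xi)(\tau)\big)\big]\ \le\ \mathbb E_{\mathbf a}\Big[\int_0^{\tau}L_{\omega(s)}\big(x+\mathcal I(\Xi)(s),-\Xi(s)\big)+\alpha\,ds\Big].$$ In particular, if $y\in\mathbb T^N$ and $\mathcal I(\Xi)(\tau)=y-x$ $\mathbb P_{\mathbf a}$-almost surely, then $$\mathbb E_{\mathbf a}\big[u_{\omega(0)}(x)-u_{\omega(\tau)}(y)\big]\ \le\ \mathbb E_{\mathbf a}\Big[\int_0^{\tau}L_{\omega(s)}\big(x+\mathcal I(\Xi)(s),-\Xi(s)\big)+\alpha\,ds\Big].$$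 -/

import Mathlib

open MeasureTheory ProbabilityTheory Filter Topology
open scoped NNReal Matrix

noncomputable section

namespace HJSystem

/-! ### Cadlag paths on the half line -/

/-- A path on `[0, ∞)` is cadlag if it is right continuous and has a left limit at every positive
time. -/
structure IsCadlag {E : Type*} [TopologicalSpace E] (ξ : ℝ≥0 → E) : Prop where
  rightContinuous : ∀ t, ContinuousWithinAt ξ (Set.Ici t) t
  leftLimit : ∀ t, 0 < t → ∃ l, Tendsto ξ (𝓝[<] t) (𝓝 l)

/-- The space of cadlag paths on `[0, ∞)` with values in `E`. -/
def CadlagPath (E : Type*) [TopologicalSpace E] : Type _ :=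
  {ξ : ℝ≥0 → E // IsCadlag ξ}

instance (E : Type*) [TopologicalSpace E] : CoeFun (CadlagPath E) (fun _ => ℝ≥0 → E) :=
  ⟨Subtype.val⟩

/-- The `σ`-algebra on path space spanned by the evaluation maps (equivalently, by cylinders). -/
instance (E : Type*) [TopologicalSpace E] [MeasurableSpace E] : MeasurableSpace (CadlagPath E) :=
  ⨆ s : ℝ≥0, MeasurableSpace.comap (fun ξ : CadlagPath E => ξ s) inferInstance

/-- The filtration on path space whose `σ`-algebra at time `t` is spanned by the evaluation maps at
the times `s ≤ t`. -/
def pathFiltration (E : Type*) [TopologicalSpace E] [MeasurableSpace E] :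
    Filtration ℝ≥0 (inferInstance : MeasurableSpace (CadlagPath E)) where
  seq t := ⨆ s : ℝ≥0, ⨆ _ : s ≤ t,
    MeasurableSpace.comap (fun ξ : CadlagPath E => ξ s) inferInstance
  mono' _ _ hst := iSup_mono fun _ => iSup_mono' fun h => ⟨h.trans hst, le_rfl⟩
  le' _ := iSup_mono fun _ => iSup_le fun _ => le_rfl

/-! ### The torus, the Hamiltonians, the coupling matrix and subsolutions -/

/-- The projection of `ℝᴺ` onto the flat torus `𝕋ᴺ = ℝᴺ / ℤᴺ`. -/
def proj {N : ℕ} (x : EuclideanSpace ℝ (Fin N)) : UnitAddTorus (Fin N) :=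
  fun k => ((x k : ℝ) : UnitAddCircle)

/-- The assumptions on a Hamiltonian `H (x, p)`, `x ∈ 𝕋ᴺ`, `p ∈ ℝᴺ`: jointly continuous, and convex
and superlinear in `p`. -/
structure IsHamiltonian {N : ℕ}
    (H : UnitAddTorus (Fin N) → EuclideanSpace ℝ (Fin N) → ℝ) : Prop where
  continuous : Continuous fun z : UnitAddTorus (Fin N) × EuclideanSpace ℝ (Fin N) => H z.1 z.2
  convex : ∀ x, ConvexOn ℝ Set.univ (H x)
  superlinear : ∀ x, Tendsto (fun p => H x p / ‖p‖) (Bornology.cobounded _) atTop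

/-- The Lagrangian `L (x, q) = max_p (p · q - H (x, p))`; the supremum is finite and attained when
`H` is continuous and superlinear in `p`. -/
def lagrangian {N : ℕ} (H : UnitAddTorus (Fin N) → EuclideanSpace ℝ (Fin N) → ℝ)
    (x : UnitAddTorus (Fin N)) (q : EuclideanSpace ℝ (Fin N)) : ℝ :=
  ⨆ p : EuclideanSpace ℝ (Fin N), (inner ℝ p q - H x p)

/-- The assumptions on the coupling matrix: nonpositive off-diagonal entries, vanishing row sums,
irreducibility. -/
structure IsCouplingMatrix {M : ℕ} (Λ : Matrix (Fin M) (Fin M) ℝ) : Prop where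
  offDiag_nonpos : ∀ i j, i ≠ j → Λ i j ≤ 0
  row_sum : ∀ i, ∑ j, Λ i j = 0
  irreducible : ∀ I : Set (Fin M), I.Nonempty → I ≠ Set.univ → ∃ i ∈ I, ∃ j ∉ I, Λ i j ≠ 0

/-- Viscosity subsolutions of the system `H_i (x, D u_i) + Λ^i · u = α`, `i = 1, …, M`, on `𝕋ᴺ`.
A test function `ψ` on the torus is of class `C¹` when its lift to `ℝᴺ` is, and its differential at
the point `proj x` is that of the lift at `x`. -/
structure IsSubsolution {M N : ℕ}
    (H : Fin M → UnitAddTorus (Fin N) → EuclideanSpace ℝ (Fin N) → ℝ)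
    (Λ : Matrix (Fin M) (Fin M) ℝ) (α : ℝ) (u : Fin M → UnitAddTorus (Fin N) → ℝ) : Prop where
  continuous : ∀ i, Continuous (u i)
  viscosity : ∀ (i : Fin M) (x : EuclideanSpace ℝ (Fin N)) (ψ : UnitAddTorus (Fin N) → ℝ),
    ContDiff ℝ 1 (fun y : EuclideanSpace ℝ (Fin N) => ψ (proj y)) →
    (∀ z, u i z - ψ z ≤ u i (proj x) - ψ (proj x)) →
    H i (proj x) (gradient (fun y : EuclideanSpace ℝ (Fin N) => ψ (proj y)) x)
      + ∑ j, Λ i j * u j (proj x) ≤ α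

/-- The critical value: the infimum of the `α` for which the system admits a subsolution. -/
def criticalValue {M N : ℕ}
    (H : Fin M → UnitAddTorus (Fin N) → EuclideanSpace ℝ (Fin N) → ℝ)
    (Λ : Matrix (Fin M) (Fin M) ℝ) : ℝ :=
  sInf {α : ℝ | ∃ u, IsSubsolution H Λ α u}

/-! ### The path measures -/

/-- `P` is the Markov chain measure on the space of cadlag paths with values in the index set, with
initial distribution `a` and rate matrix `-Λ`: the probability measure which on the cylinder
`{ω | ω (t₀) = j₀, …, ω (t_k) = j_k}`, `t₀ < ⋯ < t_k`, takes the value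
`(a e^{-t₀ Λ})_{j₀} ∏_l (e^{-(t_{l+1} - t_l) Λ})_{j_l j_{l+1}}`. Cylinders are closed under
intersection and span the `σ`-algebra, so this determines `P`. -/
structure IsChainMeasure {M : ℕ} (Λ : Matrix (Fin M) (Fin M) ℝ) (a : Fin M → ℝ)
    (P : Measure (CadlagPath (Fin M))) : Prop where
  isProbabilityMeasure : IsProbabilityMeasure P
  cylinder : ∀ (k : ℕ) (t : Fin (k + 1) → ℝ≥0) (j : Fin (k + 1) → Fin M), StrictMono t →
    P.real {ω | ∀ l, ω (t l) = j l} =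
      (a ᵥ* NormedSpace.exp (-(t 0 : ℝ) • Λ)) (j 0) *
        ∏ l : Fin k, NormedSpace.exp (-((t l.succ : ℝ) - (t l.castSucc : ℝ)) • Λ)
          (j l.castSucc) (j l.succ)

/-- There is at most one Markov chain measure with given initial distribution and rate matrix. -/
theorem IsChainMeasure.unique {M : ℕ} {Λ : Matrix (Fin M) (Fin M) ℝ} {a : Fin M → ℝ}
    {P Q : Measure (CadlagPath (Fin M))} (hP : IsChainMeasure Λ a P) (hQ : IsChainMeasure Λ a Q) :
    P = Q := by
  have := hP.isProbabilityMeasure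
  have := hQ.isProbabilityMeasure
  let C : Set (Set (CadlagPath (Fin M))) :=
    {A | ∃ (F : Finset ℝ≥0) (j : ℝ≥0 → Fin M), F.Nonempty ∧ A = {ω | ∀ s ∈ F, ω s = j s}}
  have hpi : IsPiSystem C := by
    rintro _ ⟨F, j, hF, rfl⟩ _ ⟨G, i, hG, rfl⟩ ⟨ω₀, h₁, h₂⟩
    refine ⟨F ∪ G, ω₀, hF.mono Finset.subset_union_left, ?_⟩
    ext ω
    constructor
    · rintro ⟨h₃, h₄⟩ s hs
      rcases Finset.mem_union.1 hs with h | h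
      · exact (h₃ s h).trans (h₁ s h).symm
      · exact (h₄ s h).trans (h₂ s h).symm
    · intro h
      exact ⟨fun s hs => (h s (Finset.mem_union_left _ hs)).trans (h₁ s hs),
        fun s hs => (h s (Finset.mem_union_right _ hs)).trans (h₂ s hs)⟩
  have hev : ∀ s : ℝ≥0, Measurable fun ω : CadlagPath (Fin M) => ω s := fun s =>
    (comap_measurable _).mono (le_iSup (fun s : ℝ≥0 =>
      MeasurableSpace.comap (fun ξ : CadlagPath (Fin M) => ξ s) inferInstance) s) le_rfl
  have hgen : (inferInstance : MeasurableSpace (CadlagPath (Fin M)))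
      = MeasurableSpace.generateFrom C := by
    apply le_antisymm
    · refine iSup_le fun s => ?_
      rintro _ ⟨B, -, rfl⟩
      have : (fun ξ : CadlagPath (Fin M) => ξ s) ⁻¹' B
          = ⋃ b ∈ B, {ω | ∀ r ∈ ({s} : Finset ℝ≥0), ω r = b} := by
        ext ω
        simp
      rw [this]
      exact MeasurableSet.biUnion B.to_countable fun b _ =>
        MeasurableSpace.measurableSet_generateFrom
          ⟨{s}, fun _ => b, Finset.singleton_nonempty s, rfl⟩
    · refine MeasurableSpace.generateFrom_le ?_
      rintro _ ⟨F, j, -, rfl⟩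
      have : {ω : CadlagPath (Fin M) | ∀ s ∈ F, ω s = j s}
          = ⋂ s ∈ F, (fun ω : CadlagPath (Fin M) => ω s) ⁻¹' {j s} := by
        ext ω
        simp
      rw [this]
      exact Finset.measurableSet_biInter F fun s _ => hev s (MeasurableSet.singleton _)
  refine ext_of_generate_finite C hgen hpi ?_ (by simp)
  rintro _ ⟨F, j, hF, rfl⟩
  obtain ⟨k, hk⟩ : ∃ k, F.card = k + 1 := Nat.exists_eq_succ_of_ne_zero hF.card_pos.ne'
  have hA : {ω : CadlagPath (Fin M) | ∀ s ∈ F, ω s = j s}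
      = {ω | ∀ l, ω (F.orderEmbOfFin hk l) = j (F.orderEmbOfFin hk l)} := by
    ext ω
    constructor
    · exact fun h l => h _ (F.orderEmbOfFin_mem hk l)
    · intro h s hs
      obtain ⟨l, rfl⟩ : s ∈ Set.range (F.orderEmbOfFin hk) := by
        rw [Finset.range_orderEmbOfFin]
        exact hs
      exact h l
  have h := (hP.cylinder k _ (fun l => j (F.orderEmbOfFin hk l))
    (F.orderEmbOfFin hk).strictMono).trans (hQ.cylinder k _ (fun l => j (F.orderEmbOfFin hk l))
    (F.orderEmbOfFin hk).strictMono).symm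
  rw [hA]
  exact (measureReal_eq_measureReal_iff).1 h

/-! ### Stopping times, controls and the integrated paths -/

/-- Bounded stopping times of the filtration on the space of index-valued paths. -/
def IsBoundedStoppingTime {M : ℕ} (τ : CadlagPath (Fin M) → ℝ≥0) : Prop :=
  IsStoppingTime (pathFiltration (Fin M)) (fun ω => (τ ω : WithTop ℝ≥0)) ∧ ∃ T, ∀ ω, τ ω ≤ T

/-- Admissible controls: random variables with values in the cadlag paths of `ℝᴺ`, locally (in time)
bounded up to a `P`-null set, and nonanticipating. -/
structure IsControl {M N : ℕ} (P : Measure (CadlagPath (Fin M)))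
    (Ξ : CadlagPath (Fin M) → CadlagPath (EuclideanSpace ℝ (Fin N))) : Prop where
  measurable : Measurable Ξ
  locallyBounded : ∀ t : ℝ≥0, 0 < t → ∃ R : ℝ, ∀ᵐ ω ∂P, ∀ s ≤ t, ‖Ξ ω s‖ < R
  nonanticipating : ∀ t : ℝ≥0, 0 < t → ∀ ω₁ ω₂ : CadlagPath (Fin M),
    (∀ s ≤ t, ω₁ s = ω₂ s) → ∀ s ≤ t, Ξ ω₁ s = Ξ ω₂ s

/-- The path `t ↦ proj (∫₀ᵗ ξ ds)` on the torus. -/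
def integratedPath {N : ℕ} (ξ : CadlagPath (EuclideanSpace ℝ (Fin N))) (t : ℝ≥0) :
    UnitAddTorus (Fin N) :=
  proj (∫ s in (0 : ℝ)..t, ξ s.toNNReal)

/-- The running cost `s ↦ L_{ω(s)} (x + I(ξ)(s), -ξ(s)) + α`, as a function of real time (only the
times `s ≥ 0` matter). -/
def runningCost {M N : ℕ}
    (H : Fin M → UnitAddTorus (Fin N) → EuclideanSpace ℝ (Fin N) → ℝ) (α : ℝ)
    (x : UnitAddTorus (Fin N)) (ω : CadlagPath (Fin M))
    (ξ : CadlagPath (EuclideanSpace ℝ (Fin N))) (s : ℝ) : ℝ :=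
  lagrangian (H (ω s.toNNReal)) (x + integratedPath ξ s.toNNReal) (-ξ s.toNNReal) + α

end HJSystem

end

/-! Write X_t = x + I(Ξ)(t) and Z_t = u_{ω(t)}(X_t) + ∫₀ᵗ (L_{ω(s)}(X_s, -Ξ(s)) + α) ds. The theorem
says E Z_0 ≤ E Z_τ, which is optional sampling once Z is known to behave like a submartingale. Since
u is only continuous, Dynkin's formula is not available; the motion in space and the jumps of the
index are instead separated on short intervals [s, t], h = t - s.

For a frozen index i, u_i is a viscosity subsolution of the scalar inequality H_i(x, Du_i) ≤ α -
(Λu)_i. A doubling of variables with a periodic penalization turns this into an integral inequality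
along curves with right continuous velocity (`sub_le_integral_lagrangian_along`). It is applied with
i = ω(t), on all of [s, t].

For a frozen position X_s, the Markov property (`IsChainMeasure.integral_eval`) replaces
u_{ω(t)}(X_s), under the integral over an event of F_s, by (e^{-hΛ} u(X_s))_{ω(s)} = (u -
hΛu)_{ω(s)}(X_s) + o(h). The two coupling terms cancel to first order. Replacing ω(r) or ω(s) by
ω(t) costs O(h²) in expectation, because a jump has probability O(h), and moving X_r to X_s in the
coupling costs o(h) by equicontinuity.

Hence ∫_A (Z_t - Z_s) dP ≥ -εh for A in F_s and h small, uniformly in s and A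
(`IsSubsolution.neg_le_setIntegral_costProcess`). Such errors sum to O(ε) over a time grid, and
rounding τ up to finer and finer grids gives the result by right continuity and domination
(`integral_zero_le_integral_stopped`). -/

noncomputable section

namespace HJSystem

/-! ### The Lagrangian -/

section Lagrangian

variable {N : ℕ} {H : UnitAddTorus (Fin N) → EuclideanSpace ℝ (Fin N) → ℝ}

/-- Superlinearity is assumed separately at each x. On a sphere of momenta it passes to nearby x by
compactness, and convexity along rays from 0 carries it from the sphere to everything outside. -/
theorem IsHamiltonian.eventually_superlinear (hH : IsHamiltonian H) (R : ℝ)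
    (x₀ : UnitAddTorus (Fin N)) :
    ∃ r : ℝ, 0 < r ∧ ∀ᶠ x in 𝓝 x₀, ∀ p, r ≤ ‖p‖ → H x 0 + R * ‖p‖ ≤ H x p := by
  -- The extra 1 gives strictness on the sphere; |H x₀ 0| absorbs the value at p = 0, using r ≥ 1.
  have h1 := (hH.superlinear x₀).eventually_ge_atTop (R + 1 + |H x₀ 0|)
  obtain ⟨r₀, hr₀⟩ := (hasBasis_cobounded_norm.eventually_iff).1 h1
  set r := max r₀ 1 with hr
  have hr1 : 1 ≤ r := le_max_right _ _
  have hrpos : 0 < r := by linarith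
  have hc1 : Continuous fun z : UnitAddTorus (Fin N) × EuclideanSpace ℝ (Fin N) =>
      H z.1 z.2 - H z.1 0 :=
    hH.continuous.sub (hH.continuous.comp (continuous_fst.prodMk continuous_const))
  have hsph : ∀ p ∈ Metric.sphere (0 : EuclideanSpace ℝ (Fin N)) r,
      R * r < H x₀ p - H x₀ 0 := by
    intro p hp
    have hp' : ‖p‖ = r := by simpa using hp
    have h2 := hr₀.2 (x := p) (by simp [hp', hr])
    rw [hp', le_div_iff₀ hrpos] at h2
    have h3 := le_abs_self (H x₀ 0)
    have h4 := abs_nonneg (H x₀ 0)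
    nlinarith
  have h5 : ∀ᶠ x in 𝓝 x₀, ∀ p ∈ Metric.sphere (0 : EuclideanSpace ℝ (Fin N)) r,
      R * r < H x p - H x 0 := by
    refine (isCompact_sphere _ _).eventually_forall_of_forall_eventually fun p hp => ?_
    exact hc1.continuousAt.eventually (lt_mem_nhds (hsph p hp))
  refine ⟨r, hrpos, h5.mono fun x hx p hp => ?_⟩
  have hppos : 0 < ‖p‖ := by linarith
  set l := r / ‖p‖ with hl
  have hl0 : 0 < l := by positivity
  have hl1 : l ≤ 1 := (div_le_one hppos).2 hp
  have hlp : l * ‖p‖ = r := by rw [hl]; field_simp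
  have h6 := hx (l • p) (by simp [norm_smul, abs_of_pos hl0, hlp])
  have h7 := (hH.convex x).2 (Set.mem_univ (0 : EuclideanSpace ℝ (Fin N))) (Set.mem_univ p)
    (sub_nonneg.2 hl1) hl0.le (by ring)
  simp only [smul_zero, zero_add, smul_eq_mul] at h7
  have h8 : l * (R * ‖p‖) ≤ l * (H x p - H x 0) := by
    have : l * (R * ‖p‖) = R * r := by rw [← hlp]; ring
    linarith
  have := le_of_mul_le_mul_left h8 hl0
  linarith

theorem IsHamiltonian.bddAbove (hH : IsHamiltonian H) (x : UnitAddTorus (Fin N))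
    (q : EuclideanSpace ℝ (Fin N)) :
    BddAbove (Set.range fun p : EuclideanSpace ℝ (Fin N) => inner ℝ p q - H x p) := by
  obtain ⟨r, hr, h⟩ := hH.eventually_superlinear ‖q‖ x
  have hx := h.self_of_nhds
  have hc : Continuous fun p : EuclideanSpace ℝ (Fin N) => inner ℝ p q - H x p :=
    (continuous_id.inner continuous_const).sub
      (hH.continuous.comp (continuous_const.prodMk continuous_id))
  obtain ⟨B, hB⟩ := ((isCompact_closedBall (0 : EuclideanSpace ℝ (Fin N)) r).image hc).bddAbove
  refine ⟨max B (-H x 0), ?_⟩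
  rintro _ ⟨p, rfl⟩
  rcases le_total ‖p‖ r with hp | hp
  · exact le_max_of_le_left (hB ⟨p, by simpa using hp, rfl⟩)
  · refine le_max_of_le_right ?_
    have h1 := hx p hp
    have h2 := real_inner_le_norm p q
    simp only
    linarith [mul_comm ‖p‖ ‖q‖]

/-- The Fenchel inequality. -/
theorem IsHamiltonian.inner_sub_le_lagrangian (hH : IsHamiltonian H) (x : UnitAddTorus (Fin N))
    (p q : EuclideanSpace ℝ (Fin N)) : inner ℝ p q - H x p ≤ lagrangian H x q :=
  le_ciSup (hH.bddAbove x q) p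

/-- Near (x₀, q₀) all momenta outside one fixed ball do no better than p = 0, so the supremum is
locally a supremum over a compact set of a jointly continuous function. -/
theorem IsHamiltonian.continuous_lagrangian (hH : IsHamiltonian H) :
    Continuous fun z : UnitAddTorus (Fin N) × EuclideanSpace ℝ (Fin N) =>
      lagrangian H z.1 z.2 := by
  rw [continuous_iff_continuousAt]
  rintro ⟨x₀, q₀⟩
  obtain ⟨r, hr, h⟩ := hH.eventually_superlinear (‖q₀‖ + 1) x₀
  have hK := isCompact_closedBall (0 : EuclideanSpace ℝ (Fin N)) r
  have hc : Continuous fun w : (UnitAddTorus (Fin N) × EuclideanSpace ℝ (Fin N)) ×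
      EuclideanSpace ℝ (Fin N) => inner ℝ w.2 w.1.2 - H w.1.1 w.2 :=
    (continuous_snd.inner (continuous_snd.comp continuous_fst)).sub
      (hH.continuous.comp ((continuous_fst.comp continuous_fst).prodMk continuous_snd))
  have hsup := hK.continuous_sSup (f := fun (z : UnitAddTorus (Fin N) × EuclideanSpace ℝ (Fin N))
    (p : EuclideanSpace ℝ (Fin N)) => inner ℝ p z.2 - H z.1 p) hc
  refine hsup.continuousAt.congr ?_
  have hq : ∀ᶠ q in 𝓝 q₀, ‖q‖ < ‖q₀‖ + 1 :=
    continuous_norm.continuousAt.eventually (gt_mem_nhds (by linarith))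
  rw [nhds_prod_eq]
  filter_upwards [h.prod_mk hq] with z hz
  obtain ⟨hz1, hz2⟩ := hz
  have hb : BddAbove ((fun p : EuclideanSpace ℝ (Fin N) => inner ℝ p z.2 - H z.1 p) ''
      Metric.closedBall 0 r) :=
    (hH.bddAbove z.1 z.2).mono (Set.image_subset_range _ _)
  have h0 : (0 : EuclideanSpace ℝ (Fin N)) ∈ Metric.closedBall 0 r := by simp [hr.le]
  apply le_antisymm
  · refine csSup_le ⟨_, 0, h0, rfl⟩ ?_
    rintro _ ⟨p, -, rfl⟩
    exact hH.inner_sub_le_lagrangian z.1 p z.2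
  · refine ciSup_le fun p => ?_
    rcases le_total ‖p‖ r with hp | hp
    · exact le_csSup hb ⟨p, by simpa using hp, rfl⟩
    · have h1 := hz1 p hp
      have h2 := real_inner_le_norm p z.2
      have h3 : ‖p‖ * ‖z.2‖ ≤ ‖p‖ * (‖q₀‖ + 1) :=
        mul_le_mul_of_nonneg_left hz2.le (norm_nonneg p)
      have h4 : inner ℝ (0 : EuclideanSpace ℝ (Fin N)) z.2 - H z.1 0 ≤ _ :=
        le_csSup hb ⟨0, h0, rfl⟩
      rw [inner_zero_left] at h4
      refine le_trans ?_ h4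
      linarith [mul_comm ‖p‖ (‖q₀‖ + 1)]

end Lagrangian

/-! ### A smooth periodic penalization -/

section Penalization

variable {N : ℕ}

theorem continuous_proj : Continuous (proj (N := N)) :=
  continuous_pi fun k => (AddCircle.continuous_mk' 1).comp (EuclideanSpace.proj k).continuous

theorem proj_surjective : Function.Surjective (proj (N := N)) := by
  intro z
  choose y hy using fun k => QuotientAddGroup.mk_surjective (z k)
  exact ⟨WithLp.toLp 2 y, funext hy⟩

theorem proj_add (x y : EuclideanSpace ℝ (Fin N)) : proj (x + y) = proj x + proj y := by
  ext k
  simp [proj]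

theorem proj_sub (x y : EuclideanSpace ℝ (Fin N)) : proj (x - y) = proj x - proj y := by
  ext k
  simp [proj]

/-- The function `∑ₖ (1 - cos (2 π zₖ))` on the torus. -/
def cosPenalty (z : UnitAddTorus (Fin N)) : ℝ :=
  ∑ k, (1 - (fourier 1 (z k) : ℂ).re)

theorem cosPenalty_proj (y : EuclideanSpace ℝ (Fin N)) :
    cosPenalty (proj y) = ∑ k, (1 - Real.cos (2 * Real.pi * y k)) := by
  refine Finset.sum_congr rfl fun k _ => ?_
  rw [proj, fourier_coe_apply, ← Complex.exp_ofReal_mul_I_re]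
  congr 3
  push_cast
  ring

theorem continuous_cosPenalty : Continuous (cosPenalty (N := N)) := by
  unfold cosPenalty
  fun_prop

theorem contDiff_cosPenalty_proj :
    ContDiff ℝ 1 fun y : EuclideanSpace ℝ (Fin N) => cosPenalty (proj y) := by
  simp only [cosPenalty_proj]
  fun_prop

theorem cosPenalty_nonneg (z : UnitAddTorus (Fin N)) : 0 ≤ cosPenalty z := by
  obtain ⟨y, rfl⟩ := proj_surjective z
  rw [cosPenalty_proj]
  exact Finset.sum_nonneg fun k _ => sub_nonneg.2 (Real.cos_le_one _)

theorem cosPenalty_zero : cosPenalty (0 : UnitAddTorus (Fin N)) = 0 := by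
  have := cosPenalty_proj (0 : EuclideanSpace ℝ (Fin N))
  rw [show proj (0 : EuclideanSpace ℝ (Fin N)) = 0 from funext fun k => by simp [proj]] at this
  simpa using this

theorem cosPenalty_pos {z : UnitAddTorus (Fin N)} (hz : z ≠ 0) : 0 < cosPenalty z := by
  refine (cosPenalty_nonneg z).lt_of_ne fun h => hz ?_
  obtain ⟨y, rfl⟩ := proj_surjective z
  rw [cosPenalty_proj, eq_comm,
    Finset.sum_eq_zero_iff_of_nonneg fun k _ => sub_nonneg.2 (Real.cos_le_one _)] at h
  ext k
  obtain ⟨n, hn⟩ := (Real.cos_eq_one_iff _).1 (sub_eq_zero.1 (h k (Finset.mem_univ k))).symm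
  have : y k = n := by
    have := Real.pi_pos
    have h2 : (n - y k) * (2 * Real.pi) = 0 := by linarith
    rcases mul_eq_zero.1 h2 with h3 | h3 <;> linarith
  have h4 : ((y k : ℝ) : UnitAddCircle) = 0 := by
    rw [this, AddCircle.coe_eq_zero_iff]
    exact ⟨n, by simp⟩
  exact h4

/-- The penalization controls the distance. -/
theorem exists_dist_lt_of_cosPenalty_lt {η : ℝ} (hη : 0 < η) :
    ∃ κ > 0, ∀ z w : UnitAddTorus (Fin N), cosPenalty (z - w) < κ → dist z w < η := by
  have hK : IsCompact {z : UnitAddTorus (Fin N) | η ≤ ‖z‖} :=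
    (isClosed_le continuous_const continuous_norm).isCompact
  -- The set is empty when η is large or N = 0, and any κ works; otherwise κ is the minimum of the
  -- penalty on it.
  rcases Set.eq_empty_or_nonempty {z : UnitAddTorus (Fin N) | η ≤ ‖z‖} with he | hne
  · refine ⟨1, one_pos, fun z w _ => ?_⟩
    rw [dist_eq_norm]
    by_contra h
    exact (Set.eq_empty_iff_forall_notMem.1 he) (z - w) (not_lt.1 h)
  · obtain ⟨z₀, hz₀, hmin⟩ := hK.exists_isMinOn hne continuous_cosPenalty.continuousOn
    refine ⟨cosPenalty z₀, cosPenalty_pos ?_, fun z w h => ?_⟩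
    · rintro rfl
      exact hη.not_ge (by simpa using hz₀)
    · rw [dist_eq_norm]
      by_contra h'
      exact absurd (hmin (not_lt.1 h' : z - w ∈ {z : UnitAddTorus (Fin N) | η ≤ ‖z‖})) (not_le.2 h)

end Penalization

/-! ### Subsolutions along curves -/

section Curve

variable {N : ℕ}

/-- Viscosity subsolutions of `H (x, D u) ≤ f` on the torus satisfy the corresponding integral
inequality along every curve with a bounded right continuous velocity. -/
theorem sub_le_integral_lagrangian_along
    {H : UnitAddTorus (Fin N) → EuclideanSpace ℝ (Fin N) → ℝ} (hH : IsHamiltonian H)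
    {u f : UnitAddTorus (Fin N) → ℝ} (hu : Continuous u) (hf : Continuous f)
    (hvisc : ∀ (x : EuclideanSpace ℝ (Fin N)) (ψ : UnitAddTorus (Fin N) → ℝ),
      ContDiff ℝ 1 (fun y : EuclideanSpace ℝ (Fin N) => ψ (proj y)) →
      (∀ z, u z - ψ z ≤ u (proj x) - ψ (proj x)) →
      H (proj x) (gradient (fun y : EuclideanSpace ℝ (Fin N) => ψ (proj y)) x) ≤ f (proj x))
    {ζ γ : ℝ → EuclideanSpace ℝ (Fin N)} {s t R : ℝ} (hst : s ≤ t)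
    (hγ : Continuous γ)
    (hγζ : ∀ r ∈ Set.Ico s t, HasDerivWithinAt γ (ζ r) (Set.Ioi r) r)
    (hζ : ∀ r ∈ Set.Ico s t, ContinuousWithinAt ζ (Set.Ioi r) r)
    (hζm : Measurable ζ)
    (hR : ∀ r ∈ Set.Icc s t, ‖ζ r‖ ≤ R) :
    u (proj (γ s)) - u (proj (γ t)) ≤
      ∫ r in s..t, (lagrangian H (proj (γ r)) (-ζ r) + f (proj (γ r))) := by
  rcases hst.eq_or_lt with rfl | hst
  · simp
  set G : UnitAddTorus (Fin N) × EuclideanSpace ℝ (Fin N) → ℝ :=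
    fun z => lagrangian H z.1 (-z.2) + f z.1 with hG
  have hGc : Continuous G :=
    (hH.continuous_lagrangian.comp (continuous_fst.prodMk continuous_snd.neg)).add
      (hf.comp continuous_fst)
  set g : ℝ → ℝ := fun r => G (proj (γ r), ζ r) with hg
  have hpγ : Continuous fun r => proj (γ r) := continuous_proj.comp hγ
  have hgm : Measurable g := hGc.measurable.comp (hpγ.measurable.prodMk hζm)
  have hcomp : IsCompact ((Set.univ : Set (UnitAddTorus (Fin N))) ×ˢ
      Metric.closedBall (0 : EuclideanSpace ℝ (Fin N)) R) :=
    isCompact_univ.prod (isCompact_closedBall _ _)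
  obtain ⟨B, hB⟩ := hcomp.exists_bound_of_continuousOn hGc.continuousOn
  have hgB : ∀ r ∈ Set.Icc s t, ‖g r‖ ≤ B := fun r hr =>
    hB _ ⟨Set.mem_univ _, by simpa using hR r hr⟩
  have hgi : IntervalIntegrable g volume s t := by
    rw [intervalIntegrable_iff_integrableOn_Icc_of_le hst.le]
    exact Measure.integrableOn_of_bounded (by simp) hgm.aestronglyMeasurable
      ((ae_restrict_iff' measurableSet_Icc).2 (Eventually.of_forall hgB))
  have hgc : ∀ r ∈ Set.Ico s t, ContinuousWithinAt g (Set.Ioi r) r := fun r hr =>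
    hGc.continuousAt.comp_continuousWithinAt
      (hpγ.continuousWithinAt.prodMk (hζ r hr))
  by_contra! hcon
  change ∫ r in s..t, g r < _ at hcon
  -- Half of the surplus is spent: δ(t - s) makes φ grow faster than the integral of g, and the last
  -- δ pays for replacing proj (γ t) by a nearby point.
  obtain ⟨δ, hδ, hδlt⟩ : ∃ δ > 0, (∫ r in s..t, g r) + δ * (t - s) + δ <
      u (proj (γ s)) - u (proj (γ t)) := by
    set d := u (proj (γ s)) - u (proj (γ t)) - ∫ r in s..t, g r with hd
    have hdpos : 0 < d := by linarith
    have hts : 0 < t - s + 1 := by linarith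
    refine ⟨d / (2 * (t - s + 1)), by positivity, ?_⟩
    have : d / (2 * (t - s + 1)) * (t - s) + d / (2 * (t - s + 1)) = d / 2 := by
      field_simp
    linarith
  set φ : ℝ → ℝ := fun r => (∫ r' in s..r, g r') + δ * (r - s) with hφ
  have hφs : φ s = 0 := by simp [hφ]
  have hφc : ContinuousOn φ (Set.Icc s t) := by
    refine ContinuousOn.add ?_ (by fun_prop)
    have := intervalIntegral.continuousOn_primitive_interval' hgi Set.left_mem_uIcc
    rwa [Set.uIcc_of_le hst.le] at this
  have hφd : ∀ r ∈ Set.Ico s t, HasDerivWithinAt φ (g r + δ) (Set.Ioi r) r := by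
    intro r hr
    have h1 : HasDerivWithinAt (fun r => ∫ r' in s..r, g r') (g r) (Set.Ioi r) r := by
      refine (intervalIntegral.integral_hasDerivWithinAt_right (s := Set.Ici r) (t := Set.Ioi r)
        ?_ ?_ (hgc r hr)).mono Set.Ioi_subset_Ici_self
      · exact hgi.mono_set (by
          rw [Set.uIcc_of_le hr.1, Set.uIcc_of_le hst.le]
          exact Set.Icc_subset_Icc_right hr.2.le)
      · exact hgm.stronglyMeasurable.stronglyMeasurableAtFilter
    have h2 : HasDerivWithinAt (fun r => δ * (r - s)) δ (Set.Ioi r) r := by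
      simpa using (((hasDerivAt_id r).sub_const s).const_mul δ).hasDerivWithinAt
    exact h1.add h2
  obtain ⟨η, hη, hηu⟩ : ∃ η > 0, ∀ z w : UnitAddTorus (Fin N), dist z w < η →
      u z < u w + δ ∧ ∀ q, ‖q‖ ≤ R → G (z, q) < G (w, q) + δ := by
    have h1 := CompactSpace.uniformContinuous_of_continuous hu
    have h2 := hcomp.uniformContinuousOn_of_continuous hGc.continuousOn
    obtain ⟨η₁, hη₁, h1⟩ := Metric.uniformContinuous_iff.1 h1 δ hδ
    obtain ⟨η₂, hη₂, h2⟩ := Metric.uniformContinuousOn_iff.1 h2 δ hδ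
    refine ⟨min η₁ η₂, lt_min hη₁ hη₂, fun z w hzw => ⟨?_, fun q hq => ?_⟩⟩
    · have := h1 (hzw.trans_le (min_le_left _ _))
      rw [Real.dist_eq] at this
      linarith [(abs_lt.1 this).2]
    · have := h2 (z, q) ⟨Set.mem_univ _, by simpa using hq⟩ (w, q)
        ⟨Set.mem_univ _, by simpa using hq⟩
        (by simpa [Prod.dist_eq, hη₂] using hzw.trans_le (min_le_right _ _))
      rw [Real.dist_eq] at this
      linarith [(abs_lt.1 this).2]
  obtain ⟨κ, hκ, hκη⟩ := exists_dist_lt_of_cosPenalty_lt (N := N) hη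
  obtain ⟨Bu, hBu⟩ := isCompact_univ.exists_bound_of_continuousOn hu.continuousOn
  obtain ⟨Bφ, hBφ⟩ := isCompact_Icc.exists_bound_of_continuousOn hφc
  -- With this n, comparing the maximum with the value at (s, proj (γ s)) forces the penalty below
  -- κ.
  obtain ⟨n, hn⟩ := exists_nat_gt ((2 * Bu + Bφ) / κ)
  rw [div_lt_iff₀ hκ] at hn
  set W : EuclideanSpace ℝ (Fin N) → ℝ := fun y => n * cosPenalty (proj y) with hW
  have hWd : ContDiff ℝ 1 W := contDiff_const.mul contDiff_cosPenalty_proj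
  -- Only the space variable is doubled. Time enters through φ and γ, which have right derivatives,
  -- and those suffice at a maximum with r < t.
  obtain ⟨⟨r, z⟩, ⟨hr, -⟩, hmax⟩ := (isCompact_Icc.prod isCompact_univ).exists_isMaxOn
    (f := fun w : ℝ × UnitAddTorus (Fin N) =>
      u w.2 + φ w.1 - n * cosPenalty (w.2 - proj (γ w.1)))
    (s := Set.Icc s t ×ˢ Set.univ)
    ⟨(s, 0), ⟨⟨le_rfl, hst.le⟩, Set.mem_univ _⟩⟩
    (by
      refine ContinuousOn.sub (ContinuousOn.add (hu.comp continuous_snd).continuousOn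
        (hφc.comp continuousOn_fst fun w hw => hw.1)) (Continuous.continuousOn ?_)
      exact continuous_const.mul (continuous_cosPenalty.comp
        (continuous_snd.sub (hpγ.comp continuous_fst))))
  have hmax' : ∀ r' ∈ Set.Icc s t, ∀ z', u z' + φ r' - n * cosPenalty (z' - proj (γ r')) ≤
      u z + φ r - n * cosPenalty (z - proj (γ r)) := fun r' hr' z' =>
    hmax (show (r', z') ∈ Set.Icc s t ×ˢ Set.univ from ⟨hr', Set.mem_univ _⟩)
  have hstart := hmax' s ⟨le_rfl, hst.le⟩ (proj (γ s))
  rw [sub_self, cosPenalty_zero, hφs] at hstart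
  have hnear : dist z (proj (γ r)) < η := by
    refine hκη _ _ ?_
    have h1 := abs_le.1 (hBu z (Set.mem_univ _))
    have h2 := abs_le.1 (hBu (proj (γ s)) (Set.mem_univ _))
    have h3 := abs_le.1 (hBφ r hr)
    have h4 : n * cosPenalty (z - proj (γ r)) < n * κ := by linarith
    exact lt_of_mul_lt_mul_left h4 (Nat.cast_nonneg n)
  have hpen : 0 ≤ n * cosPenalty (z - proj (γ r)) :=
    mul_nonneg (Nat.cast_nonneg n) (cosPenalty_nonneg _)
  -- At r = t there is no room to the right, but then the comparison with the start contradicts the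
  -- choice of δ.
  rcases hr.2.eq_or_lt with rfl | hrt
  · have h1 := (hηu _ _ hnear).1
    have h2 : φ r = (∫ r' in s..r, g r') + δ * (r - s) := rfl
    linarith
  have hrI : r ∈ Set.Ico s t := ⟨hr.1, hrt⟩
  obtain ⟨y, rfl⟩ := proj_surjective z
  set p := gradient W (y - γ r) with hp
  have hWg : HasGradientAt W p (y - γ r) := (hWd.differentiable one_ne_zero _).hasGradientAt
  have hsubeq : ∀ y' r', n * cosPenalty (proj y' - proj (γ r')) = W (y' - γ r') := fun y' r' => by
    simp only [hW, proj_sub]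
  have hvis := hvisc y (fun z' => n * cosPenalty (z' - proj (γ r)))
    (by
      simp only [hsubeq]
      exact hWd.comp (contDiff_id.sub contDiff_const))
    (fun z' => by linarith [hmax' r hr z'])
  have hgrad : gradient (fun y' => (fun z' => n * cosPenalty (z' - proj (γ r))) (proj y')) y
      = p := by
    simp only [hsubeq]
    refine HasGradientAt.gradient ?_
    have := hWg.hasFDerivAt.comp y ((hasFDerivAt_id y).sub_const (γ r))
    rw [hasGradientAt_iff_hasFDerivAt]
    simpa using! this
  rw [hgrad] at hvis
  have hFen := hH.inner_sub_le_lagrangian (proj y) p (-ζ r)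
  have htime : HasDerivWithinAt (fun r' => φ r' - W (y - γ r')) (g r + δ - inner ℝ p (-ζ r))
      (Set.Ioi r) r := by
    refine (hφd r hrI).sub ?_
    have h1 : HasDerivWithinAt (fun r' => y - γ r') (-ζ r) (Set.Ioi r) r :=
      (hγζ r hrI).const_sub y
    have := hWg.hasFDerivAt.comp_hasDerivWithinAt r h1
    simpa using! this
  have hle : g r + δ - inner ℝ p (-ζ r) ≤ 0 := by
    have h1 := hasDerivWithinAt_iff_tendsto_slope' (s := Set.Ioi r) (by simp) |>.1 htime
    refine le_of_tendsto h1 ?_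
    filter_upwards [Ioo_mem_nhdsGT hrt] with r' hr'
    have h2 := hmax' r' ⟨hr.1.trans hr'.1.le, hr'.2.le⟩ (proj y)
    rw [hsubeq, hsubeq] at h2
    rw [slope_def_field]
    exact div_nonpos_of_nonpos_of_nonneg (by linarith) (by linarith [hr'.1])
  -- The contradiction is g r + δ ≤ ⟨p, -ζ r⟩ ≤ L(y, -ζ r) + f(y) < g r + δ: maximality in time,
  -- then Fenchel with the viscosity inequality, then closeness of proj y to proj (γ r).
  have hclose := (hηu _ _ hnear).2 (ζ r) (hR r hr)
  have hgr : g r = G (proj (γ r), ζ r) := rfl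
  have hGy : G (proj y, ζ r) = lagrangian H (proj y) (-ζ r) + f (proj y) := rfl
  linarith

end Curve

/-! ### Measurability of right continuous processes -/

section Measurability

theorem CadlagPath.measurable_eval {E : Type*} [TopologicalSpace E] [MeasurableSpace E] (s : ℝ≥0) :
    Measurable fun ω : CadlagPath E => ω s :=
  (comap_measurable _).mono (le_iSup (fun s : ℝ≥0 =>
    MeasurableSpace.comap (fun ξ : CadlagPath E => ξ s) inferInstance) s) le_rfl

theorem CadlagPath.measurable_eval_pathFiltration {E : Type*} [TopologicalSpace E]
    [MeasurableSpace E] {s t : ℝ≥0} (hst : s ≤ t) :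
    Measurable[pathFiltration E t] fun ω : CadlagPath E => ω s :=
  (comap_measurable _).mono (le_iSup₂_of_le (f := fun (s : ℝ≥0) (_ : s ≤ t) =>
    MeasurableSpace.comap (fun ξ : CadlagPath E => ξ s) inferInstance) s hst le_rfl) le_rfl

theorem CadlagPath.measurable_of_eval {E Ω : Type*} [TopologicalSpace E] [MeasurableSpace E]
    {mΩ : MeasurableSpace Ω} {F : Ω → CadlagPath E} (hF : ∀ s, Measurable fun ω => F ω s) :
    Measurable F := by
  rw [measurable_iff_comap_le]
  change MeasurableSpace.comap F (⨆ s : ℝ≥0,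
    MeasurableSpace.comap (fun ξ : CadlagPath E => ξ s) inferInstance) ≤ mΩ
  simp only [MeasurableSpace.comap_iSup, MeasurableSpace.comap_comp]
  exact iSup_le fun s => (hF s).comap_le

/-- A right continuous process is jointly measurable. -/
theorem measurable_uncurry_of_rightContinuous {Ω E : Type*} [MeasurableSpace Ω]
    [TopologicalSpace E] [TopologicalSpace.PseudoMetrizableSpace E] [MeasurableSpace E]
    [BorelSpace E] {X : Ω → ℝ≥0 → E}
    (hX : ∀ ω t, ContinuousWithinAt (X ω) (Set.Ici t) t) (hm : ∀ t, Measurable fun ω => X ω t) :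
    Measurable fun z : Ω × ℝ≥0 => X z.1 z.2 := by
  -- Times are rounded up to multiples of 1/(n+1): countably many values, converging from the right.
  refine measurable_of_tendsto_metrizable
    (f := fun (n : ℕ) (z : Ω × ℝ≥0) => X z.1 (⌈z.2 * (n + 1)⌉₊ / (n + 1))) (fun n => ?_) ?_
  · have h1 : Measurable fun w : ℕ × Ω => X w.2 ((w.1 : ℝ≥0) / (n + 1)) :=
      measurable_from_prod_countable_right fun k => hm ((k : ℝ≥0) / (n + 1))
    have h2 : Measurable fun z : Ω × ℝ≥0 => (⌈z.2 * (n + 1)⌉₊, z.1) :=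
      (Nat.measurable_ceil.comp (measurable_snd.mul_const _)).prodMk measurable_fst
    exact h1.comp h2
  · rw [tendsto_pi_nhds]
    rintro ⟨ω, t⟩
    refine (hX ω t).tendsto.comp (tendsto_nhdsWithin_iff.2 ⟨?_, Eventually.of_forall fun n => ?_⟩)
    · have h1 := (tendsto_nat_ceil_mul_div_atTop (R := ℝ) (a := (t : ℝ)) t.2).comp
        ((tendsto_natCast_atTop_atTop (R := ℝ)).comp (tendsto_add_atTop_nat 1))
      rw [← NNReal.tendsto_coe]
      refine h1.congr fun n => ?_
      simp only [Function.comp_apply]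
      push_cast
      congr 2
    · simp only [Set.mem_Ici]
      rw [le_div_iff₀ (by positivity)]
      exact Nat.le_ceil _

theorem CadlagPath.measurable_uncurry {E : Type*} [TopologicalSpace E]
    [TopologicalSpace.PseudoMetrizableSpace E] [MeasurableSpace E] [BorelSpace E] :
    Measurable fun z : CadlagPath E × ℝ≥0 => z.1 z.2 :=
  measurable_uncurry_of_rightContinuous (fun ω t => ω.2.rightContinuous t) measurable_eval

end Measurability

/-! ### Local boundedness, stopping and integration of cadlag paths. -/

section Cadlag

/-- One-sided limits bound the path near each time, and compactness of [0, T] does the rest. The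
bound depends on the path, which is enough for integrability in time for every ω, including the null
set left out by `IsControl`. -/
theorem CadlagPath.exists_norm_le {E : Type*} [NormedAddCommGroup E] (ξ : CadlagPath E) (T : ℝ≥0) :
    ∃ R, ∀ t ≤ T, ‖ξ t‖ ≤ R := by
  have key : ∃ R, ∀ t ∈ Set.Icc 0 T, ‖ξ t‖ ≤ R := by
    refine isCompact_Icc.induction_on (p := fun A => ∃ R, ∀ t ∈ A, ‖ξ t‖ ≤ R) ⟨0, by simp⟩
      (fun A B hAB ⟨R, hR⟩ => ⟨R, fun t ht => hR t (hAB ht)⟩)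
      (fun A B ⟨R, hR⟩ ⟨R', hR'⟩ => ⟨max R R', ?_⟩) (fun t _ => ?_)
    · rintro t (ht | ht)
      · exact (hR t ht).trans (le_max_left _ _)
      · exact (hR' t ht).trans (le_max_right _ _)
    · have h1 : ∀ᶠ s in 𝓝[≥] t, ‖ξ s‖ ≤ ‖ξ t‖ + 1 :=
        (ξ.2.rightContinuous t).norm.tendsto.eventually_le_const (by linarith)
      obtain ⟨l, hl⟩ : ∃ l : E, Tendsto ξ (𝓝[<] t) (𝓝 l) := by
        rcases eq_or_ne t 0 with rfl | ht
        · refine ⟨0, ?_⟩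
          have : Set.Iio (0 : ℝ≥0) = ∅ := by ext; simp
          rw [this, nhdsWithin_empty]
          exact tendsto_bot
        · exact ξ.2.leftLimit t (pos_iff_ne_zero.2 ht)
      have h2 : ∀ᶠ s in 𝓝[<] t, ‖ξ s‖ ≤ ‖l‖ + 1 :=
        hl.norm.eventually_le_const (by linarith)
      have h3 : ∀ᶠ s in 𝓝 t, ‖ξ s‖ ≤ max (‖l‖ + 1) (‖ξ t‖ + 1) := by
        rw [← nhdsLT_sup_nhdsGE t, eventually_sup]
        exact ⟨h2.mono fun s hs => hs.trans (le_max_left _ _),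
          h1.mono fun s hs => hs.trans (le_max_right _ _)⟩
      exact ⟨_, mem_nhdsWithin_of_mem_nhds h3, _, fun s hs => hs⟩
  exact key.imp fun R hR t ht => hR t ⟨zero_le, ht⟩

/-- The path stopped at the deterministic time `t`. -/
def CadlagPath.stoppedAt {E : Type*} [TopologicalSpace E] (t : ℝ≥0) (ω : CadlagPath E) :
    CadlagPath E :=
  ⟨fun s => ω (min s t), by
    refine ⟨fun s => ?_, fun s hs => ?_⟩
    · refine (ω.2.rightContinuous (min s t)).comp (t := Set.Ici (min s t))
        (f := fun s => min s t) (by fun_prop) fun r hr => ?_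
      exact min_le_min_right t hr
    · rcases le_or_gt s t with h | h
      · obtain ⟨l, hl⟩ := ω.2.leftLimit s hs
        refine ⟨l, hl.congr' ?_⟩
        filter_upwards [self_mem_nhdsWithin] with r hr
        rw [min_eq_left (le_trans (le_of_lt hr) h)]
      · refine ⟨ω t, tendsto_const_nhds.congr' ?_⟩
        filter_upwards [mem_nhdsWithin_of_mem_nhds (lt_mem_nhds h)] with r hr
        rw [min_eq_right (le_of_lt hr)]⟩

theorem CadlagPath.stoppedAt_apply {E : Type*} [TopologicalSpace E] (t s : ℝ≥0) (ω : CadlagPath E) :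
    ω.stoppedAt t s = ω (min s t) := rfl

theorem CadlagPath.measurable_stoppedAt {E : Type*} [TopologicalSpace E] [MeasurableSpace E] (t : ℝ≥0) :
    Measurable[pathFiltration E t] (CadlagPath.stoppedAt (E := E) t) := by
  refine @measurable_of_eval E _ _ _ (pathFiltration E t) _ fun s => ?_
  exact measurable_eval_pathFiltration (min_le_right s t)

variable {N : ℕ} (ξ : CadlagPath (EuclideanSpace ℝ (Fin N)))

theorem CadlagPath.continuousWithinAt_toNNReal {E : Type*} [TopologicalSpace E] (ξ : CadlagPath E)
    (r : ℝ) : ContinuousWithinAt (fun r : ℝ => ξ r.toNNReal) (Set.Ioi r) r := by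
  refine ((ξ.2.rightContinuous r.toNNReal).comp (t := Set.Ici r.toNNReal)
    continuous_real_toNNReal.continuousWithinAt fun s hs => ?_)
  exact Real.toNNReal_le_toNNReal (le_of_lt hs)

theorem CadlagPath.measurable_toNNReal {E : Type*} [TopologicalSpace E]
    [TopologicalSpace.PseudoMetrizableSpace E] [MeasurableSpace E] [BorelSpace E]
    (ξ : CadlagPath E) : Measurable fun r : ℝ => ξ r.toNNReal :=
  CadlagPath.measurable_uncurry.comp (measurable_const.prodMk measurable_real_toNNReal)

/-- A measurable real function bounded on bounded intervals is interval integrable. -/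
theorem intervalIntegrable_of_measurable_of_bounded {E : Type*} [NormedAddCommGroup E]
    [MeasurableSpace E] [BorelSpace E] [SecondCountableTopology E]
    {f : ℝ → E} (hf : Measurable f) (hb : ∀ b : ℝ, ∃ K, ∀ r ≤ b, ‖f r‖ ≤ K) (a b : ℝ) :
    IntervalIntegrable f volume a b := by
  obtain ⟨K, hK⟩ := hb (max a b)
  rw [intervalIntegrable_iff]
  exact Measure.integrableOn_of_bounded (M := K) (by simp) hf.aestronglyMeasurable
    ((ae_restrict_iff' measurableSet_uIoc).2 (Eventually.of_forall fun r hr => hK r hr.2))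

theorem CadlagPath.intervalIntegrable (a b : ℝ) :
    IntervalIntegrable (fun r : ℝ => ξ r.toNNReal) volume a b :=
  intervalIntegrable_of_measurable_of_bounded ξ.measurable_toNNReal (fun b => by
    obtain ⟨R, hR⟩ := ξ.exists_norm_le b.toNNReal
    exact ⟨R, fun r hr => hR _ (Real.toNNReal_le_toNNReal hr)⟩) a b

theorem CadlagPath.continuous_primitive :
    Continuous fun t : ℝ => ∫ s in (0 : ℝ)..t, ξ s.toNNReal :=
  intervalIntegral.continuous_primitive ξ.intervalIntegrable 0

theorem continuous_integratedPath : Continuous (integratedPath ξ) :=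
  continuous_proj.comp (ξ.continuous_primitive.comp NNReal.continuous_coe)

theorem CadlagPath.hasDerivWithinAt_primitive (r : ℝ) :
    HasDerivWithinAt (fun t : ℝ => ∫ s in (0 : ℝ)..t, ξ s.toNNReal) (ξ r.toNNReal)
      (Set.Ioi r) r :=
  (intervalIntegral.integral_hasDerivWithinAt_right (s := Set.Ici r) (t := Set.Ioi r)
    (ξ.intervalIntegrable 0 r) ξ.measurable_toNNReal.stronglyMeasurable.stronglyMeasurableAtFilter
    (ξ.continuousWithinAt_toNNReal r)).mono Set.Ioi_subset_Ici_self

theorem integratedPath_congr {ξ ξ' : CadlagPath (EuclideanSpace ℝ (Fin N))} {t : ℝ≥0}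
    (h : ∀ s ≤ t, ξ s = ξ' s) : integratedPath ξ t = integratedPath ξ' t := by
  unfold integratedPath
  congr 1
  refine intervalIntegral.integral_congr fun s hs => h _ ?_
  rw [Set.uIcc_of_le t.coe_nonneg] at hs
  exact Real.toNNReal_le_iff_le_coe.2 hs.2

theorem measurable_integratedPath (t : ℝ≥0) :
    Measurable fun ξ : CadlagPath (EuclideanSpace ℝ (Fin N)) => integratedPath ξ t := by
  refine continuous_proj.measurable.comp ?_
  simp only [intervalIntegral.integral_of_le (NNReal.coe_nonneg _)]
  refine StronglyMeasurable.measurable ?_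
  refine StronglyMeasurable.integral_prod_right' (ν := volume.restrict (Set.Ioc 0 (t : ℝ)))
    (f := fun z : CadlagPath (EuclideanSpace ℝ (Fin N)) × ℝ => z.1 z.2.toNNReal) ?_
  exact (CadlagPath.measurable_uncurry.comp
    (measurable_fst.prodMk (measurable_real_toNNReal.comp measurable_snd))).stronglyMeasurable

theorem measurable_uncurry_integratedPath :
    Measurable fun z : CadlagPath (EuclideanSpace ℝ (Fin N)) × ℝ≥0 => integratedPath z.1 z.2 :=
  measurable_uncurry_of_rightContinuous
    (fun ξ _ => (continuous_integratedPath ξ).continuousWithinAt) measurable_integratedPath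

end Cadlag

/-! ### Adaptedness of the controlled position. -/

section Control

variable {M N : ℕ} {P : Measure (CadlagPath (Fin M))}
  {Ξ : CadlagPath (Fin M) → CadlagPath (EuclideanSpace ℝ (Fin N))}

/-- The position at time `t` of a nonanticipating control is known at time `t`. -/
theorem IsControl.measurable_integratedPath (hΞ : IsControl P Ξ) (t : ℝ≥0) :
    Measurable[pathFiltration (Fin M) t] fun ω => integratedPath (Ξ ω) t := by
  -- Nonanticipation is assumed at positive times only; at time 0 the integral vanishes.
  rcases eq_or_ne t 0 with rfl | ht
  · simp only [integratedPath, NNReal.coe_zero, intervalIntegral.integral_same]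
    exact measurable_const
  -- Nonanticipation is a statement on pairs of paths. It becomes measurability because the position
  -- factors through the path stopped at t, which is F_t-measurable.
  · have h1 : (fun ω => integratedPath (Ξ ω) t) =
        (fun ω => integratedPath (Ξ ω) t) ∘ CadlagPath.stoppedAt t := by
      funext ω
      refine integratedPath_congr fun s hs => ?_
      refine hΞ.nonanticipating t (pos_iff_ne_zero.2 ht) _ _ (fun r hr => ?_) s hs
      rw [CadlagPath.stoppedAt_apply, min_eq_left hr]
    rw [h1]
    exact ((HJSystem.measurable_integratedPath t).comp hΞ.measurable).comp
      (CadlagPath.measurable_stoppedAt t)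

end Control

/-! ### Measurability and integrability of the running cost. -/

section Cost

variable {M N : ℕ} {H : Fin M → UnitAddTorus (Fin N) → EuclideanSpace ℝ (Fin N) → ℝ}

theorem measurable_runningCost (hH : ∀ i, IsHamiltonian (H i)) (α : ℝ) (x : UnitAddTorus (Fin N)) :
    Measurable fun z : (CadlagPath (Fin M) × CadlagPath (EuclideanSpace ℝ (Fin N))) × ℝ =>
      runningCost H α x z.1.1 z.1.2 z.2 := by
  have h1 : Measurable fun w : Fin M × UnitAddTorus (Fin N) × EuclideanSpace ℝ (Fin N) =>
      lagrangian (H w.1) w.2.1 w.2.2 :=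
    measurable_from_prod_countable_right fun i => (hH i).continuous_lagrangian.measurable
  have ht : Measurable fun z : (CadlagPath (Fin M) × CadlagPath (EuclideanSpace ℝ (Fin N))) × ℝ =>
      z.2.toNNReal := measurable_real_toNNReal.comp measurable_snd
  have hω := CadlagPath.measurable_uncurry.comp
    ((measurable_fst.comp measurable_fst).prodMk ht)
  have hξ := (measurable_snd.comp measurable_fst).prodMk ht
  exact (h1.comp (hω.prodMk ((measurable_const.add (measurable_uncurry_integratedPath.comp
    hξ)).prodMk (CadlagPath.measurable_uncurry.comp hξ).neg))).add_const α

theorem exists_abs_lagrangian_le (hH : ∀ i, IsHamiltonian (H i)) (R : ℝ) :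
    ∃ K, 0 ≤ K ∧ ∀ i z q, ‖q‖ ≤ R → |lagrangian (H i) z q| ≤ K := by
  have h1 : ∀ i, ∃ K, ∀ z q, ‖q‖ ≤ R → |lagrangian (H i) z q| ≤ K := fun i => by
    obtain ⟨K, hK⟩ := (isCompact_univ.prod
      (isCompact_closedBall (0 : EuclideanSpace ℝ (Fin N)) R)).exists_bound_of_continuousOn
      (hH i).continuous_lagrangian.continuousOn
    exact ⟨K, fun z q hq => hK (z, q) ⟨Set.mem_univ _, by simpa using hq⟩⟩
  choose K hK using h1
  refine ⟨∑ i, |K i|, Finset.sum_nonneg fun i _ => abs_nonneg _, fun i z q hq => ?_⟩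
  exact (hK i z q hq).trans ((le_abs_self _).trans
    (Finset.single_le_sum (f := fun i => |K i|) (fun i _ => abs_nonneg _) (Finset.mem_univ i)))

theorem intervalIntegrable_runningCost (hH : ∀ i, IsHamiltonian (H i)) (α : ℝ)
    (x : UnitAddTorus (Fin N)) (ω : CadlagPath (Fin M))
    (ξ : CadlagPath (EuclideanSpace ℝ (Fin N))) (a b : ℝ) :
    IntervalIntegrable (runningCost H α x ω ξ) volume a b := by
  refine intervalIntegrable_of_measurable_of_bounded
    ((measurable_runningCost hH α x).comp (measurable_const (a := (ω, ξ)) |>.prodMk measurable_id))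
    (fun b => ?_) a b
  obtain ⟨R, hR⟩ := ξ.exists_norm_le b.toNNReal
  obtain ⟨K, -, hK⟩ := exists_abs_lagrangian_le hH R
  refine ⟨K + |α|, fun r hr => (abs_add_le _ _).trans (add_le_add_left (hK _ _ _ ?_) _)⟩
  rw [norm_neg]
  exact hR _ (Real.toNNReal_le_toNNReal hr)

theorem measurable_integral_runningCost (hH : ∀ i, IsHamiltonian (H i)) (α : ℝ)
    (x : UnitAddTorus (Fin N)) :
    Measurable fun z : (CadlagPath (Fin M) × CadlagPath (EuclideanSpace ℝ (Fin N))) × ℝ≥0 =>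
      ∫ s in (0 : ℝ)..z.2, runningCost H α x z.1.1 z.1.2 s := by
  refine measurable_uncurry_of_rightContinuous
    (X := fun (y : CadlagPath (Fin M) × CadlagPath (EuclideanSpace ℝ (Fin N))) (t : ℝ≥0) =>
      ∫ s in (0 : ℝ)..t, runningCost H α x y.1 y.2 s) (fun y t => ?_) fun t => ?_
  · exact ((intervalIntegral.continuous_primitive
      (intervalIntegrable_runningCost hH α x y.1 y.2) 0).comp
      NNReal.continuous_coe).continuousWithinAt
  · simp only [intervalIntegral.integral_of_le (NNReal.coe_nonneg _)]
    exact ((measurable_runningCost hH α x).stronglyMeasurable.integral_prod_right'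
      (ν := volume.restrict (Set.Ioc 0 (t : ℝ)))).measurable

end Cost

/-! ### The Markov property -/

section Markov

variable {M : ℕ} {Λ : Matrix (Fin M) (Fin M) ℝ} {a : Fin M → ℝ} {P : Measure (CadlagPath (Fin M))}

theorem measurableSet_eval_eq (s : ℝ≥0) (i : Fin M) :
    MeasurableSet {ω : CadlagPath (Fin M) | ω s = i} :=
  CadlagPath.measurable_eval s (measurableSet_singleton i)

/-- Cylinders based on the times up to `s`. -/
def cylindersUpTo (M : ℕ) (s : ℝ≥0) : Set (Set (CadlagPath (Fin M))) :=
  {A | ∃ (F : Finset ℝ≥0) (j : ℝ≥0 → Fin M), (∀ r ∈ F, r ≤ s) ∧ A = {ω | ∀ r ∈ F, ω r = j r}}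

theorem isPiSystem_cylindersUpTo (s : ℝ≥0) : IsPiSystem (cylindersUpTo M s) := by
  rintro _ ⟨F, j, hF, rfl⟩ _ ⟨G, i, hG, rfl⟩ ⟨ω₀, h₁, h₂⟩
  refine ⟨F ∪ G, ω₀, fun r hr => (Finset.mem_union.1 hr).elim (hF r) (hG r), ?_⟩
  ext ω
  constructor
  · rintro ⟨h₃, h₄⟩ r hr
    rcases Finset.mem_union.1 hr with h | h
    · exact (h₃ r h).trans (h₁ r h).symm
    · exact (h₄ r h).trans (h₂ r h).symm
  · intro h
    exact ⟨fun r hr => (h r (Finset.mem_union_left _ hr)).trans (h₁ r hr),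
      fun r hr => (h r (Finset.mem_union_right _ hr)).trans (h₂ r hr)⟩

theorem pathFiltration_eq_generateFrom (s : ℝ≥0) :
    (pathFiltration (Fin M) s : MeasurableSpace (CadlagPath (Fin M))) =
      MeasurableSpace.generateFrom (cylindersUpTo M s) := by
  apply le_antisymm
  · refine iSup₂_le fun r hr => ?_
    rintro _ ⟨B, -, rfl⟩
    have : (fun ξ : CadlagPath (Fin M) => ξ r) ⁻¹' B
        = ⋃ b ∈ B, {ω | ∀ q ∈ ({r} : Finset ℝ≥0), ω q = b} := by
      ext ω
      simp
    rw [this]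
    exact MeasurableSet.biUnion B.to_countable fun b _ =>
      MeasurableSpace.measurableSet_generateFrom ⟨{r}, fun _ => b, by simpa using hr, rfl⟩
  · refine MeasurableSpace.generateFrom_le ?_
    rintro _ ⟨F, j, hF, rfl⟩
    have : {ω : CadlagPath (Fin M) | ∀ r ∈ F, ω r = j r}
        = ⋂ r ∈ F, (fun ω : CadlagPath (Fin M) => ω r) ⁻¹' {j r} := by
      ext ω
      simp
    rw [this]
    exact Finset.measurableSet_biInter F fun r hr =>
      CadlagPath.measurable_eval_pathFiltration (hF r hr) (measurableSet_singleton _)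

/-- Since s is the last time of F, appending t adds exactly one transition factor to the cylinder
formula. -/
theorem IsChainMeasure.cylinder_snoc (hP : IsChainMeasure Λ a P) (F : Finset ℝ≥0) {s t : ℝ≥0}
    (hF : ∀ r ∈ F, r ≤ s) (hs : s ∈ F) (hst : s < t) (j : ℝ≥0 → Fin M) (i : Fin M) :
    P.real {ω | (∀ r ∈ F, ω r = j r) ∧ ω t = i} =
      P.real {ω | ∀ r ∈ F, ω r = j r} * NormedSpace.exp (-((t : ℝ) - s) • Λ) (j s) i := by
  obtain ⟨k, hk⟩ : ∃ k, F.card = k + 1 :=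
    Nat.exists_eq_succ_of_ne_zero (Finset.card_pos.2 ⟨s, hs⟩).ne'
  set e := F.orderEmbOfFin hk with he
  have hmem : ∀ r, r ∈ F ↔ ∃ l, e l = r := fun r => by
    rw [← Finset.mem_coe, ← F.range_orderEmbOfFin hk]
    rfl
  have hlast : e (Fin.last k) = s := by
    apply le_antisymm (hF _ (F.orderEmbOfFin_mem hk _))
    obtain ⟨l, hl⟩ := (hmem s).1 hs
    rw [← hl]
    exact e.monotone (Fin.le_last l)
  have h1 : {ω : CadlagPath (Fin M) | ∀ r ∈ F, ω r = j r} = {ω | ∀ l, ω (e l) = j (e l)} := by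
    ext ω
    exact ⟨fun h l => h _ (F.orderEmbOfFin_mem hk l), fun h r hr => by
      obtain ⟨l, rfl⟩ := (hmem r).1 hr
      exact h l⟩
  set e' : Fin (k + 2) → ℝ≥0 := Fin.snoc (α := fun _ => ℝ≥0) e t with he'
  set j' : Fin (k + 2) → Fin M := Fin.snoc (α := fun _ => Fin M) (fun l => j (e l)) i with hj'
  have h2 : {ω : CadlagPath (Fin M) | (∀ r ∈ F, ω r = j r) ∧ ω t = i} =
      {ω | ∀ l, ω (e' l) = j' l} := by
    ext ω
    rw [Set.mem_ofPred_eq, Set.mem_ofPred_eq, Fin.forall_fin_succ']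
    simp only [he', hj', Fin.snoc_castSucc, Fin.snoc_last]
    exact and_congr_left fun _ => Set.ext_iff.1 h1 ω
  have hmono : StrictMono e' := by
    rw [Fin.strictMono_iff_lt_succ]
    intro l
    induction l using Fin.lastCases with
    | last => simpa [he', hlast] using hst
    | cast l =>
      rw [Fin.succ_castSucc]
      simp only [he', Fin.snoc_castSucc]
      exact e.strictMono Fin.castSucc_lt_succ
  rw [h1, h2, hP.cylinder k e _ e.strictMono, hP.cylinder (k + 1) e' j' hmono,
    Fin.prod_univ_castSucc, ← mul_assoc]
  have h0 : (0 : Fin (k + 2)) = Fin.castSucc 0 := rfl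
  simp only [h0, Fin.succ_castSucc, Fin.succ_last, he', hj', Fin.snoc_castSucc, Fin.snoc_last,
    hlast]

/-- The Markov property on events. -/
theorem IsChainMeasure.measureReal_inter (hP : IsChainMeasure Λ a P) {s t : ℝ≥0} (hst : s < t)
    {A : Set (CadlagPath (Fin M))} (hA : MeasurableSet[pathFiltration (Fin M) s] A)
    (i j : Fin M) :
    P.real (A ∩ ({ω | ω s = i} ∩ {ω | ω t = j})) =
      P.real (A ∩ {ω | ω s = i}) * NormedSpace.exp (-((t : ℝ) - s) • Λ) i j := by
  have := hP.isProbabilityMeasure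
  set e := NormedSpace.exp (-((t : ℝ) - s) • Λ) i j with he
  have hcyl : ∀ A ∈ cylindersUpTo M s, P.real (A ∩ ({ω | ω s = i} ∩ {ω | ω t = j})) =
      P.real (A ∩ {ω | ω s = i}) * e := by
    rintro _ ⟨F, k, hF, rfl⟩
    -- The cylinder may already prescribe a state at s other than i. If it does not conflict, all
    -- prescribed states can be read off a single ω₀, which merges s into F.
    rcases Set.eq_empty_or_nonempty ({ω : CadlagPath (Fin M) | ∀ r ∈ F, ω r = k r} ∩
      {ω | ω s = i}) with h | ⟨ω₀, h₁, h₂⟩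
    · rw [← Set.inter_assoc, h]
      simp
    · have hset : {ω : CadlagPath (Fin M) | ∀ r ∈ F, ω r = k r} ∩ {ω | ω s = i} =
          {ω | ∀ r ∈ insert s F, ω r = ω₀ r} := by
        ext ω
        simp only [Set.mem_inter_iff, Set.mem_ofPred_eq, Finset.mem_insert, forall_eq_or_imp]
        rw [Set.mem_ofPred_eq] at h₂
        rw [h₂, and_comm]
        exact and_congr_right fun _ => forall₂_congr fun r hr => by rw [h₁ r hr]
      rw [← Set.inter_assoc, hset]
      have := hP.cylinder_snoc (insert s F) (s := s) (t := t) (by simpa using hF) (by simp) hst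
        ω₀ j
      rw [Set.mem_ofPred_eq] at h₂
      rw [h₂] at this
      exact this
  set B : Set (CadlagPath (Fin M)) := {ω | ω s = i} with hB
  set C : Set (CadlagPath (Fin M)) := {ω | ω t = j} with hC
  have hBm : MeasurableSet B := measurableSet_eval_eq s i
  have hCm : MeasurableSet C := measurableSet_eval_eq t j
  have huniv : P.real (B ∩ C) = P.real B * e := by
    have := hcyl Set.univ ⟨∅, fun _ => i, by simp, by simp⟩
    simpa using this
  -- The entry e must be nonnegative to scale a measure. When P(B) > 0 this follows from the
  -- identity on the whole space; otherwise both sides vanish.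
  by_cases hp : P.real B = 0
  · rw [measureReal_mono_null (Set.inter_subset_right.trans Set.inter_subset_left) hp,
      measureReal_mono_null Set.inter_subset_right hp, zero_mul]
  have he0 : 0 ≤ e := by
    by_contra! h
    have h1 : 0 < P.real B := lt_of_le_of_ne measureReal_nonneg (Ne.symm hp)
    have h2 : 0 ≤ P.real (B ∩ C) := measureReal_nonneg
    nlinarith
  have hle := (pathFiltration (Fin M)).le s
  have key : (P.restrict (B ∩ C)).trim hle = (ENNReal.ofReal e • P.restrict B).trim hle := by
    have hconv : ∀ A, MeasurableSet[pathFiltration (Fin M) s] A →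
        P.real (A ∩ (B ∩ C)) = P.real (A ∩ B) * e →
        (P.restrict (B ∩ C)).trim hle A = (ENNReal.ofReal e • P.restrict B).trim hle A := by
      intro A hA h
      rw [trim_measurableSet_eq hle hA, trim_measurableSet_eq hle hA,
        Measure.restrict_apply (hle _ hA), Measure.smul_apply, Measure.restrict_apply (hle _ hA),
        ← ofReal_measureReal, h, ENNReal.ofReal_mul measureReal_nonneg, ofReal_measureReal,
        smul_eq_mul, mul_comm]
    refine ext_of_generate_finite _ (pathFiltration_eq_generateFrom s)
      (isPiSystem_cylindersUpTo s) (fun A hA => hconv A ?_ (hcyl A hA))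
      (hconv _ MeasurableSet.univ (by simpa using huniv))
    rw [pathFiltration_eq_generateFrom]
    exact MeasurableSpace.measurableSet_generateFrom hA
  have hkey := congrArg (fun μ => μ A) key
  rw [trim_measurableSet_eq hle hA, trim_measurableSet_eq hle hA,
    Measure.restrict_apply (hle _ hA), Measure.smul_apply, Measure.restrict_apply (hle _ hA),
    smul_eq_mul] at hkey
  rw [measureReal_def, hkey, ENNReal.toReal_mul, ENNReal.toReal_ofReal he0, mul_comm,
    measureReal_def]

/-- The candidate is checked on events of F_s, split according to the state at time s. -/
theorem IsChainMeasure.condExp_indicator (hP : IsChainMeasure Λ a P) {s t : ℝ≥0} (hst : s < t)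
    (j : Fin M) :
    (fun ω : CadlagPath (Fin M) => NormedSpace.exp (-((t : ℝ) - s) • Λ) (ω s) j) =ᵐ[P]
      P[{ω : CadlagPath (Fin M) | ω t = j}.indicator (fun _ => (1 : ℝ)) |
        pathFiltration (Fin M) s] := by
  have := hP.isProbabilityMeasure
  set e := NormedSpace.exp (-((t : ℝ) - s) • Λ) with he
  have hm : Measurable[pathFiltration (Fin M) s] fun ω : CadlagPath (Fin M) => e (ω s) j :=
    (measurable_from_top (f := fun i => e i j)).comp
      (CadlagPath.measurable_eval_pathFiltration le_rfl)
  have hle := (pathFiltration (Fin M)).le s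
  have hsum : (fun ω : CadlagPath (Fin M) => e (ω s) j) =
      fun ω => ∑ i, {ω : CadlagPath (Fin M) | ω s = i}.indicator (fun _ => e i j) ω := by
    funext ω
    simp [Set.indicator_apply]
  have hint : Integrable (fun ω : CadlagPath (Fin M) => e (ω s) j) P := by
    rw [hsum]
    exact integrable_finsetSum _ fun i _ =>
      (integrable_const _).indicator (measurableSet_eval_eq s i)
  refine ae_eq_condExp_of_forall_setIntegral_eq hle
    ((integrable_const _).indicator (measurableSet_eval_eq t j))
    (fun A _ _ => hint.integrableOn) (fun A hA _ => ?_) ?_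
  · have hA' := hle _ hA
    rw [hsum, integral_finsetSum _ fun i _ => (Integrable.indicator (μ := P.restrict A)
      (integrable_const (e i j)) (measurableSet_eval_eq s i))]
    simp only [setIntegral_indicator (measurableSet_eval_eq _ _), setIntegral_const, smul_eq_mul,
      mul_one]
    have h1 : A ∩ {ω : CadlagPath (Fin M) | ω t = j} =
        ⋃ i, A ∩ ({ω | ω s = i} ∩ {ω | ω t = j}) := by
      ext ω
      simp
    rw [h1, measureReal_iUnion_fintype]
    · exact Finset.sum_congr rfl fun i _ => (hP.measureReal_inter hst hA i j).symm
    · intro i i' hii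
      refine Set.disjoint_left.2 fun ω h h' => hii ?_
      exact h.2.1.symm.trans h'.2.1
    · exact fun i => hA'.inter ((measurableSet_eval_eq s i).inter (measurableSet_eval_eq t j))
  · exact hm.stronglyMeasurable.aestronglyMeasurable

/-- The Markov property on functions. -/
theorem IsChainMeasure.integral_eval (hP : IsChainMeasure Λ a P) {s t : ℝ≥0} (hst : s < t)
    {V : CadlagPath (Fin M) → Fin M → ℝ}
    (hV : ∀ j, Measurable[pathFiltration (Fin M) s] fun ω => V ω j)
    {K : ℝ} (hK : ∀ ω j, |V ω j| ≤ K) :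
    ∫ ω, V ω (ω t) ∂P =
      ∫ ω, ∑ j, NormedSpace.exp (-((t : ℝ) - s) • Λ) (ω s) j * V ω j ∂P := by
  have := hP.isProbabilityMeasure
  set e := NormedSpace.exp (-((t : ℝ) - s) • Λ) with he
  have hle := (pathFiltration (Fin M)).le s
  have hsum : (fun ω : CadlagPath (Fin M) => V ω (ω t)) =
      fun ω => ∑ j, V ω j * {ω : CadlagPath (Fin M) | ω t = j}.indicator (fun _ => 1) ω := by
    funext ω
    simp [Set.indicator_apply]
  have hind : ∀ j, Integrable ({ω : CadlagPath (Fin M) | ω t = j}.indicator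
      fun _ => (1 : ℝ)) P := fun j => (integrable_const _).indicator (measurableSet_eval_eq t j)
  have hVm : ∀ j, AEStronglyMeasurable (fun ω => V ω j) P := fun j =>
    ((hV j).mono hle le_rfl).aestronglyMeasurable
  have hbdd : ∀ j, ∀ᵐ ω ∂P, ‖V ω j‖ ≤ K := fun j => Eventually.of_forall fun ω => hK ω j
  have hce := fun j => hP.condExp_indicator hst j
  have hint : ∀ j, Integrable
      (fun ω => V ω j * {ω : CadlagPath (Fin M) | ω t = j}.indicator (fun _ => 1) ω) P :=
    fun j => (hind j).bdd_mul (hVm j) (hbdd j)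
  have hint' : ∀ j, Integrable (fun ω : CadlagPath (Fin M) => e (ω s) j * V ω j) P := fun j => by
    simp only [mul_comm (e _ _)]
    exact (integrable_condExp.congr (hce j).symm).bdd_mul (hVm j) (hbdd j)
  rw [hsum, integral_finsetSum _ fun j _ => hint j, integral_finsetSum _ fun j _ => hint' j]
  refine Finset.sum_congr rfl fun j _ => ?_
  rw [← integral_condExp hle]
  refine integral_congr_ae ?_
  have hpull := condExp_mul_of_stronglyMeasurable_left (μ := P) (hV j).stronglyMeasurable
    (hint j) (hind j)
  filter_upwards [hpull, hce j] with ω h1 h2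
  refine h1.trans ?_
  rw [Pi.mul_apply, ← h2, mul_comm]

/-- The expansion of the transition matrix at small times. -/
theorem exists_abs_exp_sub_le (Λ : Matrix (Fin M) (Fin M) ℝ) {ε : ℝ} (hε : 0 < ε) :
    ∃ h₀ > 0, ∀ h : ℝ, 0 < h → h < h₀ → ∀ i j,
      |NormedSpace.exp (-h • Λ) i j - ((1 : Matrix (Fin M) (Fin M) ℝ) i j - h * Λ i j)| ≤
        ε * h := by
  -- An auxiliary norm, used to differentiate the exponential at 0; the conclusion is entrywise.
  let : NormedRing (Matrix (Fin M) (Fin M) ℝ) := Matrix.linftyOpNormedRing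
  let : NormedAlgebra ℝ (Matrix (Fin M) (Fin M) ℝ) := Matrix.linftyOpNormedAlgebra
  have hd := hasDerivAt_exp_smul_const (𝕂 := ℝ) (-Λ) (0 : ℝ)
  rw [zero_smul, NormedSpace.exp_zero, one_mul] at hd
  have hev : ∀ i j, ∀ᶠ h in 𝓝 (0 : ℝ),
      |NormedSpace.exp (-h • Λ) i j - ((1 : Matrix (Fin M) (Fin M) ℝ) i j - h * Λ i j)| ≤
        ε * |h| := by
    intro i j
    have h1 : HasDerivAt (fun h : ℝ => NormedSpace.exp (h • -Λ) i j) (-Λ i j) 0 :=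
      (LinearMap.toContinuousLinearMap
        (Matrix.entryLinearMap ℝ ℝ i j)).hasFDerivAt.comp_hasDerivAt (0 : ℝ) hd
    filter_upwards [(hasDerivAt_iff_isLittleO.1 h1).def hε] with h hh
    rw [zero_smul, NormedSpace.exp_zero, sub_zero, smul_eq_mul, Real.norm_eq_abs,
      Real.norm_eq_abs, smul_neg, ← neg_smul] at hh
    convert! hh using 2
    ring
  have hall : ∀ᶠ h in 𝓝 (0 : ℝ), ∀ i j,
      |NormedSpace.exp (-h • Λ) i j - ((1 : Matrix (Fin M) (Fin M) ℝ) i j - h * Λ i j)| ≤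
        ε * |h| := eventually_all.2 fun i => eventually_all.2 fun j => hev i j
  obtain ⟨h₀, hh₀, hball⟩ := Metric.eventually_nhds_iff.1 hall
  refine ⟨h₀, hh₀, fun h hpos hlt i j => ?_⟩
  have := hball (y := h) (by simpa [abs_of_pos hpos] using hlt) i j
  rwa [abs_of_pos hpos] at this

/-- The probability of a jump in a short time interval is at most proportional to its length. -/
theorem IsChainMeasure.exists_measureReal_ne_le (hP : IsChainMeasure Λ a P) :
    ∃ C ≥ 0, ∃ h₀ > 0, ∀ s t : ℝ≥0, s ≤ t → (t : ℝ) - s < h₀ →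
      P.real {ω | ω s ≠ ω t} ≤ C * ((t : ℝ) - s) := by
  have := hP.isProbabilityMeasure
  obtain ⟨h₀, hh₀, hexp⟩ := exists_abs_exp_sub_le Λ one_pos
  -- Off the diagonal, the expansion with error 1 · h bounds a transition probability by (1 + |Λ i
  -- j|) h.
  refine ⟨∑ i, ∑ j, (1 + |Λ i j|), by positivity, h₀, hh₀, fun s t hst hlt => ?_⟩
  rcases hst.eq_or_lt with rfl | hst
  · simp
  have hpos : (0 : ℝ) < t - s := sub_pos.2 (NNReal.coe_lt_coe.2 hst)
  have hsub : {ω : CadlagPath (Fin M) | ω s ≠ ω t} ⊆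
      ⋃ i, ⋃ j, (if i = j then ∅ else {ω : CadlagPath (Fin M) | ω s = i} ∩ {ω | ω t = j}) := by
    intro ω hω
    refine Set.mem_iUnion₂.2 ⟨ω s, ω t, ?_⟩
    rw [if_neg hω]
    exact ⟨rfl, rfl⟩
  refine (measureReal_mono hsub).trans ((measureReal_iUnion_fintype_le _).trans ?_)
  rw [Finset.sum_mul]
  refine Finset.sum_le_sum fun i _ => (measureReal_iUnion_fintype_le _).trans ?_
  rw [Finset.sum_mul]
  refine Finset.sum_le_sum fun j _ => ?_
  split_ifs with hij
  · simp only [measureReal_empty]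
    positivity
  · have h1 := hP.measureReal_inter hst (A := Set.univ) MeasurableSet.univ i j
    rw [Set.univ_inter, Set.univ_inter] at h1
    rw [h1]
    have h2 := abs_le.1 (hexp _ hpos hlt i j)
    rw [Matrix.one_apply_ne hij] at h2
    have h3 : NormedSpace.exp (-((t : ℝ) - s) • Λ) i j ≤ (1 + |Λ i j|) * (t - s) := by
      have := neg_abs_le (Λ i j)
      nlinarith [h2.2]
    have h4 : P.real {ω : CadlagPath (Fin M) | ω s = i} ≤ 1 := measureReal_le_one
    have h5 : (0 : ℝ) ≤ P.real {ω : CadlagPath (Fin M) | ω s = i} := measureReal_nonneg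
    have h6 : 0 ≤ (1 + |Λ i j|) * ((t : ℝ) - s) := by positivity
    calc _ ≤ P.real {ω : CadlagPath (Fin M) | ω s = i} * ((1 + |Λ i j|) * (t - s)) :=
          mul_le_mul_of_nonneg_left h3 h5
      _ ≤ _ := mul_le_of_le_one_left h6 h4

end Markov

/-! ### Optional sampling for approximate submartingales -/

section OptionalSampling

theorem sum_range_ite_sub {g : ℕ → ℝ} {m n : ℕ} (h : m ≤ n) :
    ∑ k ∈ Finset.range n, (if k < m then g (k + 1) - g k else 0) = g m - g 0 := by
  rw [← Finset.sum_filter, ← Finset.sum_range_sub]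
  congr 1
  ext k
  simp only [Finset.mem_filter, Finset.mem_range]
  omega

/-- The submartingale inequality may fail by o(t - s), uniformly in s and in the event. A grid on
[0, T] has total length T, so these errors still sum to something arbitrarily small. -/
theorem integral_zero_le_integral_stopped {Ω : Type*} {m : MeasurableSpace Ω} {P : Measure Ω}
    [IsProbabilityMeasure P] (ℱ : Filtration ℝ≥0 m) {Z : Ω → ℝ≥0 → ℝ} {τ : Ω → ℝ≥0} {T : ℝ≥0}
    {K : ℝ} (hZm : Measurable fun z : Ω × ℝ≥0 => Z z.1 z.2)
    (hZc : ∀ ω t, ContinuousWithinAt (Z ω) (Set.Ici t) t)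
    (hZK : ∀ᵐ ω ∂P, ∀ t ≤ T, |Z ω t| ≤ K)
    (hτ : ∀ s, MeasurableSet[ℱ s] {ω | s < τ ω}) (hτT : ∀ ω, τ ω ≤ T) (hT : 0 < T)
    (hstep : ∀ ε > 0, ∃ h₀ > (0 : ℝ), ∀ s t : ℝ≥0, s < t → t ≤ T → (t : ℝ) - s < h₀ →
      ∀ A, MeasurableSet[ℱ s] A → -(ε * ((t : ℝ) - s)) ≤ ∫ ω in A, (Z ω t - Z ω s) ∂P) :
    ∫ ω, Z ω 0 ∂P ≤ ∫ ω, Z ω (τ ω) ∂P := by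
  have hτm : Measurable τ := measurable_of_Ioi fun s => ℱ.le s _ (hτ s)
  have hmeas : ∀ ρ : Ω → ℝ≥0, Measurable ρ → Measurable fun ω => Z ω (ρ ω) := fun ρ hρ =>
    hZm.comp (measurable_id.prodMk hρ)
  have hint : ∀ ρ : Ω → ℝ≥0, Measurable ρ → (∀ ω, ρ ω ≤ T) →
      Integrable (fun ω => Z ω (ρ ω)) P := fun ρ hρ hρT =>
    Integrable.of_bound (hmeas ρ hρ).aestronglyMeasurable K
      (hZK.mono fun ω h => h _ (hρT ω))
  -- τ is rounded up, so that σ n tends to τ from the right, where Z is continuous.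
  set σ : ℕ → Ω → ℝ≥0 := fun n ω => ⌈τ ω / (T / (n + 1))⌉₊ * (T / (n + 1)) with hσ
  have hhpos : ∀ n : ℕ, 0 < T / ((n : ℝ≥0) + 1) := fun n => by positivity
  have hceil : ∀ (n : ℕ) ω, ⌈τ ω / (T / ((n : ℝ≥0) + 1))⌉₊ ≤ n + 1 := fun n ω => by
    refine Nat.ceil_le.2 ((div_le_iff₀ (hhpos n)).2 ?_)
    push_cast
    rw [mul_div_cancel₀ _ (by positivity)]
    exact hτT ω
  have hgrid : ∀ n k : ℕ, k ≤ n + 1 → k * (T / ((n : ℝ≥0) + 1)) ≤ T := fun n k hk => by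
    have : ((n : ℝ≥0) + 1) * (T / ((n : ℝ≥0) + 1)) = T := mul_div_cancel₀ _ (by positivity)
    calc (k : ℝ≥0) * (T / ((n : ℝ≥0) + 1)) ≤ ((n : ℝ≥0) + 1) * (T / ((n : ℝ≥0) + 1)) := by
          gcongr
          exact_mod_cast hk
      _ = T := this
  have hσm : ∀ n, Measurable (σ n) := fun n =>
    (measurable_from_top.comp (Nat.measurable_ceil.comp (hτm.div_const _))).mul_const _
  have hσT : ∀ n ω, σ n ω ≤ T := fun n ω => hgrid n _ (hceil n ω)
  have hστ : ∀ n ω, τ ω ≤ σ n ω := fun n ω => (div_le_iff₀ (hhpos n)).1 (Nat.le_ceil _)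
  have hστ' : ∀ n ω, σ n ω ≤ τ ω + T / (n + 1) := fun n ω => by
    have h1 := (Nat.ceil_lt_add_one (zero_le (a := τ ω / (T / ((n : ℝ≥0) + 1))))).le
    calc σ n ω ≤ (τ ω / (T / ((n : ℝ≥0) + 1)) + 1) * (T / (n + 1)) :=
          mul_le_mul_of_nonneg_right h1 zero_le
      _ = τ ω + T / (n + 1) := by
        rw [add_mul, one_mul, div_mul_cancel₀ _ (hhpos n).ne']
  have hhlim : Tendsto (fun n : ℕ => T / ((n : ℝ≥0) + 1)) atTop (𝓝 0) := by
    have := (tendsto_one_div_add_atTop_nhds_zero_nat (𝕜 := ℝ≥0)).const_mul T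
    simpa [div_eq_mul_inv] using this
  have hσlim : ∀ ω, Tendsto (fun n => σ n ω) atTop (𝓝[≥] (τ ω)) := fun ω => by
    refine tendsto_nhdsWithin_iff.2 ⟨?_, Eventually.of_forall fun n => hστ n ω⟩
    refine tendsto_of_tendsto_of_tendsto_of_le_of_le tendsto_const_nhds ?_
      (fun n => hστ n ω) (fun n => hστ' n ω)
    simpa using hhlim.const_add (τ ω)
  have hlim : Tendsto (fun n => ∫ ω, Z ω (σ n ω) ∂P) atTop (𝓝 (∫ ω, Z ω (τ ω) ∂P)) := by
    refine tendsto_integral_of_dominated_convergence (fun _ => K)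
      (fun n => (hmeas _ (hσm n)).aestronglyMeasurable) (integrable_const K)
      (fun n => hZK.mono fun ω h => h _ (hσT n ω))
      (Eventually.of_forall fun ω => (hZc ω (τ ω)).tendsto.comp (hσlim ω))
  refine le_of_forall_pos_le_add fun ε hε => ?_
  -- There are n + 1 steps of length T/(n+1), so an error rate ε/T adds up to ε.
  obtain ⟨h₀, hh₀, hst⟩ := hstep (ε / T) (by positivity)
  have hev : ∀ᶠ n : ℕ in atTop, ((T / ((n : ℝ≥0) + 1) : ℝ≥0) : ℝ) < h₀ :=
    (NNReal.tendsto_coe.2 hhlim).eventually_lt_const (by simpa using hh₀)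
  suffices h : ∀ᶠ n in atTop, ∫ ω, Z ω 0 ∂P - ε ≤ ∫ ω, Z ω (σ n ω) ∂P by
    linarith [ge_of_tendsto hlim h]
  filter_upwards [hev] with n hn
  set h := T / ((n : ℝ≥0) + 1) with hh
  -- The k-th increment is counted exactly when kh < τ, an event known at time kh, the left end of
  -- the step.
  have hpt : ∀ ω, Z ω (σ n ω) - Z ω 0 = ∑ k ∈ Finset.range (n + 1),
      {ω | k * h < τ ω}.indicator (fun ω => Z ω ((k + 1 : ℕ) * h) - Z ω (k * h)) ω := fun ω => by
    have h1 := sum_range_ite_sub (g := fun k : ℕ => Z ω (k * h)) (hceil n ω)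
    simp only [Nat.cast_zero, zero_mul] at h1
    refine h1.symm.trans (Finset.sum_congr rfl fun k _ => ?_)
    simp only [Set.indicator_apply, Set.mem_ofPred_eq, Nat.lt_ceil, lt_div_iff₀ (hhpos n)]
    rfl
  have hsum : ∫ ω, Z ω (σ n ω) ∂P - ∫ ω, Z ω 0 ∂P = ∑ k ∈ Finset.range (n + 1),
      ∫ ω in {ω | k * h < τ ω}, (Z ω ((k + 1 : ℕ) * h) - Z ω (k * h)) ∂P := by
    rw [← integral_sub (hint _ (hσm n) (hσT n)) (hint _ measurable_const fun _ => zero_le)]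
    simp only [hpt]
    rw [integral_finsetSum]
    · exact Finset.sum_congr rfl fun k _ => integral_indicator (ℱ.le _ _ (hτ _))
    · intro k hk
      have hk' := Finset.mem_range.1 hk
      exact ((hint _ measurable_const fun _ => hgrid n _ hk').sub
        (hint _ measurable_const fun _ => hgrid n _ hk'.le)).indicator (ℱ.le _ _ (hτ _))
  have hterm : ∀ k ∈ Finset.range (n + 1), -(ε / T * h) ≤
      ∫ ω in {ω | k * h < τ ω}, (Z ω ((k + 1 : ℕ) * h) - Z ω (k * h)) ∂P := by
    intro k hk
    have hk' := Finset.mem_range.1 hk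
    have heq : (((k + 1 : ℕ) * h : ℝ≥0) : ℝ) - ((k * h : ℝ≥0) : ℝ) = h := by
      push_cast
      ring
    have := hst (k * h) ((k + 1 : ℕ) * h)
      (mul_lt_mul_of_pos_right (by exact_mod_cast Nat.lt_succ_self k) (hhpos n))
      (hgrid n _ hk') (by rwa [heq]) _ (hτ _)
    rwa [heq] at this
  have hge := Finset.sum_le_sum hterm
  rw [← hsum, Finset.sum_const, Finset.card_range, nsmul_eq_mul] at hge
  have hT' : (T : ℝ) ≠ 0 := by exact_mod_cast hT.ne'
  have htot : ((n + 1 : ℕ) : ℝ) * -(ε / T * h) = -ε := by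
    rw [hh]
    push_cast
    field_simp
  linarith

end OptionalSampling

/-! ### Subsolutions along cadlag controls -/

section Pathwise

variable {M N : ℕ} {H : Fin M → UnitAddTorus (Fin N) → EuclideanSpace ℝ (Fin N) → ℝ}
  {Λ : Matrix (Fin M) (Fin M) ℝ} {α : ℝ} {u : Fin M → UnitAddTorus (Fin N) → ℝ}

/-- For a fixed i the coupling is a given continuous function of x, and the i-th inequality becomes
scalar. -/
theorem IsSubsolution.sub_le_integral (hu : IsSubsolution H Λ α u) {i : Fin M}
    (hH : IsHamiltonian (H i)) (x : UnitAddTorus (Fin N))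
    (ξ : CadlagPath (EuclideanSpace ℝ (Fin N))) {s t : ℝ≥0} (hst : s ≤ t) :
    u i (x + integratedPath ξ s) - u i (x + integratedPath ξ t) ≤
      ∫ r in (s : ℝ)..t, (lagrangian (H i) (x + integratedPath ξ r.toNNReal) (-ξ r.toNNReal) +
        (α - ∑ j, Λ i j * u j (x + integratedPath ξ r.toNNReal))) := by
  obtain ⟨y, rfl⟩ := proj_surjective x
  set γ : ℝ → EuclideanSpace ℝ (Fin N) := fun r => y + ∫ r' in (0 : ℝ)..r, ξ r'.toNNReal with hγ
  have hpγ : ∀ r : ℝ, 0 ≤ r → proj (γ r) = proj y + integratedPath ξ r.toNNReal := fun r hr => by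
    rw [hγ, proj_add, integratedPath, Real.coe_toNNReal r hr]
  obtain ⟨R, hR⟩ := ξ.exists_norm_le t
  have key := sub_le_integral_lagrangian_along hH (hu.continuous i)
    (f := fun z => α - ∑ j, Λ i j * u j z)
    (continuous_const.sub (continuous_finsetSum _ fun j _ =>
      continuous_const.mul (hu.continuous j)))
    (fun x ψ hψ hmax => by linarith [hu.viscosity i x ψ hψ hmax])
    (ζ := fun r => ξ r.toNNReal) (γ := γ) (s := s) (t := t) (R := R) (by exact_mod_cast hst)
    (continuous_const.add ξ.continuous_primitive)
    (fun r _ => (ξ.hasDerivWithinAt_primitive r).const_add y)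
    (fun r _ => ξ.continuousWithinAt_toNNReal r) ξ.measurable_toNNReal
    (fun r hr => hR _ (Real.toNNReal_le_iff_le_coe.2 hr.2))
  rw [hpγ s s.2, hpγ t t.2, Real.toNNReal_coe, Real.toNNReal_coe] at key
  refine key.trans (le_of_eq (intervalIntegral.integral_congr fun r hr => ?_))
  rw [Set.uIcc_of_le (by exact_mod_cast hst)] at hr
  simp only [hpγ r (s.2.trans hr.1)]

theorem IsSubsolution.exists_abs_le (hu : IsSubsolution H Λ α u) :
    ∃ B, 0 ≤ B ∧ ∀ i z, |u i z| ≤ B := by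
  choose B hB using fun i => isCompact_univ.exists_bound_of_continuousOn
    (hu.continuous i).continuousOn
  refine ⟨∑ i, |B i|, Finset.sum_nonneg fun i _ => abs_nonneg _, fun i z => ?_⟩
  exact (hB i z (Set.mem_univ z)).trans ((le_abs_self _).trans
    (Finset.single_le_sum (f := fun i => |B i|) (fun i _ => abs_nonneg _) (Finset.mem_univ i)))

/-- The values of the subsolution along controls bounded by `R` are equicontinuous in time. -/
theorem IsSubsolution.exists_abs_sub_le (hu : IsSubsolution H Λ α u) (R : ℝ) {ε : ℝ} (hε : 0 < ε) :
    ∃ h₀ > (0 : ℝ), ∀ (x : UnitAddTorus (Fin N)) (ξ : CadlagPath (EuclideanSpace ℝ (Fin N)))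
      (s r : ℝ≥0), s ≤ r → (r : ℝ) - s < h₀ → (∀ q ≤ r, ‖ξ q‖ ≤ R) →
      ∀ j, |u j (x + integratedPath ξ r) - u j (x + integratedPath ξ s)| ≤ ε := by
  have h1 : ∀ j, ∀ᶠ w in 𝓝 (0 : UnitAddTorus (Fin N)), ∀ z, |u j (z + w) - u j z| ≤ ε := by
    intro j
    obtain ⟨η, hη, h⟩ := Metric.uniformContinuous_iff.1
      (CompactSpace.uniformContinuous_of_continuous (hu.continuous j)) ε hε
    filter_upwards [Metric.ball_mem_nhds _ hη] with w hw z
    have := h (a := z + w) (b := z) (by simpa [dist_eq_norm] using hw)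
    rw [Real.dist_eq] at this
    exact this.le
  have h2 : Tendsto (proj (N := N)) (𝓝 0) (𝓝 0) := by
    have := continuous_proj (N := N).tendsto 0
    rwa [show proj (0 : EuclideanSpace ℝ (Fin N)) = 0 from funext fun k => by simp [proj]] at this
  obtain ⟨ρ, hρ, h3⟩ := Metric.eventually_nhds_iff.1 (h2.eventually (eventually_all.2 h1))
  -- The displacement is at most |R| (r - s) < ρ; the 1 covers R = 0.
  refine ⟨ρ / (|R| + 1), by positivity, fun x ξ s r hsr hlt hR j => ?_⟩
  have hint : ∫ q in (0 : ℝ)..r, ξ q.toNNReal =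
      (∫ q in (0 : ℝ)..s, ξ q.toNNReal) + ∫ q in (s : ℝ)..r, ξ q.toNNReal :=
    (intervalIntegral.integral_add_adjacent_intervals (ξ.intervalIntegrable _ _)
      (ξ.intervalIntegrable _ _)).symm
  have hnorm : ‖∫ q in (s : ℝ)..r, ξ q.toNNReal‖ ≤ |R| * |(r : ℝ) - s| := by
    refine intervalIntegral.norm_integral_le_of_norm_le_const fun q hq => ?_
    rw [Set.uIoc_of_le (by exact_mod_cast hsr)] at hq
    exact (hR _ (Real.toNNReal_le_iff_le_coe.2 hq.2)).trans (le_abs_self R)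
  have hsr' : (0 : ℝ) ≤ (r : ℝ) - s := sub_nonneg.2 (by exact_mod_cast hsr)
  have hdist : dist (∫ q in (s : ℝ)..r, ξ q.toNNReal) 0 < ρ := by
    rw [dist_zero_right]
    rw [abs_of_nonneg hsr'] at hnorm
    rw [lt_div_iff₀ (by positivity)] at hlt
    nlinarith
  have := h3 hdist j (x + integratedPath ξ s)
  rwa [add_assoc, integratedPath, ← proj_add, ← hint] at this

end Pathwise

/-! ### The one-step estimate: approximate submartingale property. -/

section Step

variable {M N : ℕ} {H : Fin M → UnitAddTorus (Fin N) → EuclideanSpace ℝ (Fin N) → ℝ}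
  {Λ : Matrix (Fin M) (Fin M) ℝ} {α : ℝ} {u : Fin M → UnitAddTorus (Fin N) → ℝ}

theorem measurable_jump :
    Measurable fun z : CadlagPath (Fin M) × ℝ≥0 × ℝ≥0 =>
      if z.1 z.2.1 = z.1 z.2.2 then (0 : ℝ) else 1 := by
  have h1 : Measurable fun z : CadlagPath (Fin M) × ℝ≥0 × ℝ≥0 => z.1 z.2.1 :=
    CadlagPath.measurable_uncurry.comp (measurable_fst.prodMk (measurable_fst.comp measurable_snd))
  have h2 : Measurable fun z : CadlagPath (Fin M) × ℝ≥0 × ℝ≥0 => z.1 z.2.2 :=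
    CadlagPath.measurable_uncurry.comp (measurable_fst.prodMk (measurable_snd.comp measurable_snd))
  exact Measurable.ite (measurableSet_eq_fun h1 h2) measurable_const measurable_const

theorem intervalIntegrable_jump (ω : CadlagPath (Fin M)) (t : ℝ≥0) (a b : ℝ) :
    IntervalIntegrable (fun r : ℝ => if ω r.toNNReal = ω t then (0 : ℝ) else 1) volume a b :=
  intervalIntegrable_of_measurable_of_bounded
    (measurable_jump.comp (measurable_const.prodMk
      (measurable_real_toNNReal.prodMk measurable_const)))
    (fun _ => ⟨1, fun r _ => by dsimp only [Function.comp_apply]; split_ifs <;> simp⟩) a b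

/-- The increment of the subsolution along a path, compared with the running cost and with the
infinitesimal generator frozen at the initial time. -/
theorem IsSubsolution.sub_le_integral_runningCost (hu : IsSubsolution H Λ α u)
    (hH : ∀ i, IsHamiltonian (H i)) (x : UnitAddTorus (Fin N)) (ω : CadlagPath (Fin M))
    (ξ : CadlagPath (EuclideanSpace ℝ (Fin N))) {s t : ℝ≥0} (hst : s ≤ t) {R K B ε : ℝ}
    (hξ : ∀ q ≤ t, ‖ξ q‖ ≤ R) (hK : ∀ i z q, ‖q‖ ≤ R → |lagrangian (H i) z q| ≤ K)
    (hB : ∀ i z, |u i z| ≤ B) (hε : ∀ r, s ≤ r → r ≤ t → ∀ j,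
      |u j (x + integratedPath ξ r) - u j (x + integratedPath ξ s)| ≤ ε) :
    u (ω t) (x + integratedPath ξ s) - u (ω t) (x + integratedPath ξ t) ≤
      (∫ r in (s : ℝ)..t, runningCost H α x ω ξ r)
      - ((t : ℝ) - s) * ∑ j, Λ (ω s) j * u j (x + integratedPath ξ s)
      + 2 * K * (∫ r in (s : ℝ)..t, if ω r.toNNReal = ω t then (0 : ℝ) else 1)
      + ((t : ℝ) - s) * (2 * (∑ i, ∑ j, |Λ i j|) * B) * (if ω s = ω t then 0 else 1)
      + ((t : ℝ) - s) * ((∑ i, ∑ j, |Λ i j|) * ε) := by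
  set D := ∑ i, ∑ j, |Λ i j| with hD
  have hst' : (s : ℝ) ≤ t := by exact_mod_cast hst
  have hrow : ∀ i (v : Fin M → ℝ) (c : ℝ), (∀ j, |v j| ≤ c) → 0 ≤ c →
      |∑ j, Λ i j * v j| ≤ D * c := by
    intro i v c hv hc
    calc |∑ j, Λ i j * v j| ≤ ∑ j, |Λ i j * v j| := Finset.abs_sum_le_sum_abs _ _
      _ ≤ ∑ j, |Λ i j| * c := Finset.sum_le_sum fun j _ => by
          rw [abs_mul]
          exact mul_le_mul_of_nonneg_left (hv j) (abs_nonneg _)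
      _ = (∑ j, |Λ i j|) * c := (Finset.sum_mul _ _ _).symm
      _ ≤ D * c := mul_le_mul_of_nonneg_right (Finset.single_le_sum
          (f := fun i => ∑ j, |Λ i j|) (fun i _ => Finset.sum_nonneg fun j _ => abs_nonneg _)
          (Finset.mem_univ i)) hc
  have hBpos : 0 ≤ B := (abs_nonneg _).trans (hB (ω t) x)
  have hεpos : 0 ≤ ε := (abs_nonneg _).trans (hε s le_rfl hst (ω t))
  set J : ℝ → ℝ := fun r => if ω r.toNNReal = ω t then (0 : ℝ) else 1 with hJ
  set S := ∑ j, Λ (ω s) j * u j (x + integratedPath ξ s) with hS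
  set E := 2 * D * B * (if ω s = ω t then (0 : ℝ) else 1) with hE
  have hcont : Continuous fun r : ℝ => ∑ j, Λ (ω t) j * u j (x + integratedPath ξ r.toNNReal) :=
    continuous_finsetSum _ fun j _ => continuous_const.mul ((hu.continuous j).comp
      (continuous_const.add ((continuous_integratedPath ξ).comp continuous_real_toNNReal)))
  have hint1 : IntervalIntegrable (fun r : ℝ =>
      lagrangian (H (ω t)) (x + integratedPath ξ r.toNNReal) (-ξ r.toNNReal) +
        (α - ∑ j, Λ (ω t) j * u j (x + integratedPath ξ r.toNNReal))) volume s t := by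
    -- A family of Hamiltonians constant in the index turns the Lagrangian frozen at ω t into a
    -- running cost.
    have h1 := (intervalIntegrable_runningCost (H := fun _ : Fin M => H (ω t))
      (fun _ => hH (ω t)) α x ω ξ s t).sub (hcont.intervalIntegrable s t)
    refine h1.congr fun r _ => ?_
    simp only [runningCost]
    ring
  have hintc := intervalIntegrable_runningCost hH α x ω ξ s t
  have hintJ := intervalIntegrable_jump ω t s t
  -- Three replacements at each time r: the index of L from ω t to ω r costs 2K off their
  -- coincidence, the row of Λ from ω t to ω s costs 2DB after a jump, and the position from r to s
  -- costs Dε.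
  have hmono := intervalIntegral.integral_mono_on (μ := volume) hst' hint1
    (((hintc.add (hintJ.const_mul (2 * K))).add
      (intervalIntegrable_const (c := -S + E + D * ε)))) (fun r hr => by
    have hrt : r.toNNReal ≤ t := Real.toNNReal_le_iff_le_coe.2 hr.2
    have hsr : s ≤ r.toNNReal := by
      rw [← Real.toNNReal_coe (r := s)]
      exact Real.toNNReal_le_toNNReal hr.1
    have hL : lagrangian (H (ω t)) (x + integratedPath ξ r.toNNReal) (-ξ r.toNNReal) ≤
        lagrangian (H (ω r.toNNReal)) (x + integratedPath ξ r.toNNReal) (-ξ r.toNNReal) +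
          2 * K * J r := by
      by_cases h : ω r.toNNReal = ω t
      · simp [hJ, h]
      · have hq : ‖-ξ r.toNNReal‖ ≤ R := by
          rw [norm_neg]
          exact hξ _ hrt
        have h1 := abs_le.1 (hK (ω t) (x + integratedPath ξ r.toNNReal) _ hq)
        have h2 := abs_le.1 (hK (ω r.toNNReal) (x + integratedPath ξ r.toNNReal) _ hq)
        simp only [hJ, if_neg h]
        linarith
    have h3 := abs_le.1 (hrow (ω t) (fun j => u j (x + integratedPath ξ r.toNNReal) -
      u j (x + integratedPath ξ s)) ε (hε _ hsr hrt) hεpos)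
    simp only [mul_sub, Finset.sum_sub_distrib] at h3
    have h4 : S - ∑ j, Λ (ω t) j * u j (x + integratedPath ξ s) ≤ E := by
      by_cases h : ω s = ω t
      · simp [hE, hS, h]
      · have h5 := abs_le.1 (hrow (ω t) (fun j => u j (x + integratedPath ξ s)) B
          (fun j => hB j _) hBpos)
        have h6 := abs_le.1 (hrow (ω s) (fun j => u j (x + integratedPath ξ s)) B
          (fun j => hB j _) hBpos)
        simp only [hE, if_neg h]
        linarith [h5.1, h6.2]
    simp only [runningCost]
    linarith [h3.1])
  refine (hu.sub_le_integral (hH (ω t)) x ξ hst).trans (hmono.trans (le_of_eq ?_))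
  have hadd := intervalIntegral.integral_add (hintc.add (hintJ.const_mul (2 * K)))
    (intervalIntegrable_const (μ := volume) (a := (s : ℝ)) (b := t) (c := -S + E + D * ε))
  have hadd' := intervalIntegral.integral_add hintc (hintJ.const_mul (2 * K))
  rw [hadd, hadd', intervalIntegral.integral_const_mul, intervalIntegral.integral_const,
    smul_eq_mul]
  ring

variable {a : Fin M → ℝ} {P : Measure (CadlagPath (Fin M))}

theorem IsChainMeasure.integral_jump (hP : IsChainMeasure Λ a P) (s t : ℝ≥0) :
    ∫ ω : CadlagPath (Fin M), (if ω s = ω t then (0 : ℝ) else 1) ∂P =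
      P.real {ω | ω s ≠ ω t} := by
  have := hP.isProbabilityMeasure
  have hm : MeasurableSet {ω : CadlagPath (Fin M) | ω s ≠ ω t} :=
    (measurableSet_eq_fun (CadlagPath.measurable_eval s) (CadlagPath.measurable_eval t)).compl
  rw [← integral_indicator_one hm]
  congr 1
  funext ω
  by_cases h : ω s = ω t <;> simp [h]

/-- The expected time during a short interval for which the chain is not in its final state. -/
theorem IsChainMeasure.integral_integral_jump_le (hP : IsChainMeasure Λ a P) {s t : ℝ≥0}
    (hst : s ≤ t) {c : ℝ} (hc : ∀ r, s ≤ r → r ≤ t → P.real {ω | ω r ≠ ω t} ≤ c) :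
    Integrable (fun ω : CadlagPath (Fin M) =>
      ∫ r in (s : ℝ)..t, if ω r.toNNReal = ω t then (0 : ℝ) else 1) P ∧
    ∫ ω : CadlagPath (Fin M), (∫ r in (s : ℝ)..t, if ω r.toNNReal = ω t then (0 : ℝ) else 1) ∂P ≤
      c * ((t : ℝ) - s) := by
  have := hP.isProbabilityMeasure
  have hst' : (s : ℝ) ≤ t := by exact_mod_cast hst
  have hm : Measurable fun z : CadlagPath (Fin M) × ℝ =>
      if z.1 z.2.toNNReal = z.1 t then (0 : ℝ) else 1 :=
    measurable_jump.comp (measurable_fst.prodMk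
      ((measurable_real_toNNReal.comp measurable_snd).prodMk measurable_const))
  have hint : Integrable (Function.uncurry fun (ω : CadlagPath (Fin M)) (r : ℝ) =>
      if ω r.toNNReal = ω t then (0 : ℝ) else 1) (P.prod (volume.restrict (Set.Ioc (s : ℝ) t))) :=
    Integrable.of_bound hm.aestronglyMeasurable 1 (Eventually.of_forall fun z => by
      simp only [Function.uncurry]
      split_ifs <;> simp)
  simp only [intervalIntegral.integral_of_le hst']
  refine ⟨hint.integral_prod_left, ?_⟩
  rw [integral_integral_swap hint, ← intervalIntegral.integral_of_le hst']
  simp only [hP.integral_jump]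
  have := intervalIntegral.norm_integral_le_of_norm_le_const (a := (s : ℝ)) (b := t)
    (f := fun r : ℝ => P.real {ω : CadlagPath (Fin M) | ω r.toNNReal ≠ ω t}) (C := c)
    (fun r hr => by
      rw [Set.uIoc_of_le hst'] at hr
      rw [Real.norm_of_nonneg measureReal_nonneg]
      refine hc _ ?_ (Real.toNNReal_le_iff_le_coe.2 hr.2)
      rw [← Real.toNNReal_coe (r := s)]
      exact Real.toNNReal_le_toNNReal hr.1.le)
  rw [abs_of_nonneg (sub_nonneg.2 hst')] at this
  exact (le_abs_self _).trans this

theorem measurable_eval_integratedPath (hu : IsSubsolution H Λ α u) (x : UnitAddTorus (Fin N)) :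
    Measurable fun z : (CadlagPath (Fin M) × CadlagPath (EuclideanSpace ℝ (Fin N))) ×
      ℝ≥0 × ℝ≥0 => u (z.1.1 z.2.1) (x + integratedPath z.1.2 z.2.2) := by
  have h1 : Measurable fun w : Fin M × UnitAddTorus (Fin N) => u w.1 w.2 :=
    measurable_from_prod_countable_right fun i => (hu.continuous i).measurable
  have h2 := CadlagPath.measurable_uncurry.comp
    ((measurable_fst.comp measurable_fst : Measurable fun z : (CadlagPath (Fin M) ×
      CadlagPath (EuclideanSpace ℝ (Fin N))) × ℝ≥0 × ℝ≥0 => z.1.1).prodMk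
      (measurable_fst.comp measurable_snd))
  have h3 := measurable_uncurry_integratedPath.comp
    ((measurable_snd.comp measurable_fst : Measurable fun z : (CadlagPath (Fin M) ×
      CadlagPath (EuclideanSpace ℝ (Fin N))) × ℝ≥0 × ℝ≥0 => z.1.2).prodMk
      (measurable_snd.comp measurable_snd))
  exact h1.comp (h2.prodMk (measurable_const.add h3))

/-- The process `u_{ω(t)} (x + I(Ξ)(t)) + ∫₀ᵗ (L + α) ds`. -/
def costProcess (H : Fin M → UnitAddTorus (Fin N) → EuclideanSpace ℝ (Fin N) → ℝ) (α : ℝ)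
    (u : Fin M → UnitAddTorus (Fin N) → ℝ)
    (Ξ : CadlagPath (Fin M) → CadlagPath (EuclideanSpace ℝ (Fin N))) (x : UnitAddTorus (Fin N))
    (ω : CadlagPath (Fin M)) (t : ℝ≥0) : ℝ :=
  u (ω t) (x + integratedPath (Ξ ω) t) + ∫ r in (0 : ℝ)..t, runningCost H α x ω (Ξ ω) r

variable {Ξ : CadlagPath (Fin M) → CadlagPath (EuclideanSpace ℝ (Fin N))}

theorem abs_integral_runningCost_le (x : UnitAddTorus (Fin N)) (ω : CadlagPath (Fin M))
    (ξ : CadlagPath (EuclideanSpace ℝ (Fin N))) {s t : ℝ≥0} (hst : s ≤ t) {R K : ℝ}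
    (hξ : ∀ q ≤ t, ‖ξ q‖ ≤ R) (hK : ∀ i z q, ‖q‖ ≤ R → |lagrangian (H i) z q| ≤ K) :
    |∫ r in (s : ℝ)..t, runningCost H α x ω ξ r| ≤ (K + |α|) * ((t : ℝ) - s) := by
  have hst' : (s : ℝ) ≤ t := by exact_mod_cast hst
  have := intervalIntegral.norm_integral_le_of_norm_le_const (a := (s : ℝ)) (b := t)
    (f := runningCost H α x ω ξ) (C := K + |α|) (fun r hr => by
      rw [Set.uIoc_of_le hst'] at hr
      refine (abs_add_le _ _).trans (add_le_add_left (hK _ _ _ ?_) _)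
      rw [norm_neg]
      exact hξ _ (Real.toNNReal_le_iff_le_coe.2 hr.2))
  rwa [abs_of_nonneg (sub_nonneg.2 hst')] at this

/-- The process `costProcess` is approximately a submartingale over short time intervals. -/
theorem IsSubsolution.neg_le_setIntegral_costProcess (hu : IsSubsolution H Λ α u)
    (hH : ∀ i, IsHamiltonian (H i)) (hP : IsChainMeasure Λ a P) (hΞ : IsControl P Ξ)
    (x : UnitAddTorus (Fin N)) {T : ℝ≥0} {R : ℝ} (hR : ∀ᵐ ω ∂P, ∀ s ≤ T, ‖Ξ ω s‖ ≤ R)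
    {ε : ℝ} (hε : 0 < ε) :
    ∃ h₀ > (0 : ℝ), ∀ s t : ℝ≥0, s < t → t ≤ T → (t : ℝ) - s < h₀ →
      ∀ A, MeasurableSet[pathFiltration (Fin M) s] A →
        -(ε * ((t : ℝ) - s)) ≤
          ∫ ω in A, (costProcess H α u Ξ x ω t - costProcess H α u Ξ x ω s) ∂P := by
  have := hP.isProbabilityMeasure
  obtain ⟨K, hK0, hK⟩ := exists_abs_lagrangian_le hH R
  obtain ⟨B, hB0, hB⟩ := hu.exists_abs_le
  set D := ∑ i, ∑ j, |Λ i j| with hD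
  have hD0 : 0 ≤ D := by positivity
  obtain ⟨C, hC0, h₁, hh₁, hC⟩ := hP.exists_measureReal_ne_le
  -- δ controls two errors: M B δ h from expanding the exponential and D δ h from freezing the
  -- position. Together they use half of ε.
  set δ := ε / (2 * (M * B + D + 1)) with hδ
  have hδ0 : 0 < δ := by positivity
  have hδε : (M * B + D) * δ ≤ ε / 2 := by
    have h1 : (M * B + D + 1) * δ = ε / 2 := by
      rw [hδ]
      field_simp
    linarith
  obtain ⟨h₂, hh₂, hmod⟩ := hu.exists_abs_sub_le R hδ0
  obtain ⟨h₃, hh₃, hexp⟩ := exists_abs_exp_sub_le Λ hδ0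
  -- The jump errors are at most (Q - 1) h², which h < ε/(2Q) makes at most (ε/2) h; the 1 keeps Q
  -- positive.
  set Q := 2 * K * C + 2 * D * B * C + 1 with hQ
  have hQ0 : 0 < Q := by positivity
  refine ⟨min (min h₁ h₂) (min h₃ (ε / (2 * Q))), by positivity, fun s t hst htT hlt A hA => ?_⟩
  obtain ⟨⟨hlt₁, hlt₂⟩, hlt₃, hlt₄⟩ := by simpa only [lt_min_iff] using hlt
  set h := (t : ℝ) - s with hh
  have hpos : 0 < h := sub_pos.2 (NNReal.coe_lt_coe.2 hst)
  have hle := (pathFiltration (Fin M)).le s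
  have hA' : MeasurableSet A := hle _ hA
  have hpair : Measurable fun ω : CadlagPath (Fin M) => (ω, Ξ ω) :=
    measurable_id.prodMk hΞ.measurable
  have hev : ∀ p q : ℝ≥0, Measurable fun ω : CadlagPath (Fin M) =>
      u (ω p) (x + integratedPath (Ξ ω) q) := fun p q =>
    (measurable_eval_integratedPath hu x).comp (hpair.prodMk (measurable_const (a := (p, q))))
  have hevi : ∀ p q : ℝ≥0, Integrable (fun ω : CadlagPath (Fin M) =>
      u (ω p) (x + integratedPath (Ξ ω) q)) P := fun p q =>
    Integrable.of_bound (hev p q).aestronglyMeasurable B (Eventually.of_forall fun ω => hB _ _)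
  have huj : ∀ j, Measurable[pathFiltration (Fin M) s] fun ω : CadlagPath (Fin M) =>
      u j (x + integratedPath (Ξ ω) s) := fun j =>
    (hu.continuous j).measurable.comp ((measurable_const_add x).comp (hΞ.measurable_integratedPath s))
  have hcoef : ∀ (Γ : Matrix (Fin M) (Fin M) ℝ), Integrable (fun ω : CadlagPath (Fin M) =>
      ∑ j, Γ (ω s) j * u j (x + integratedPath (Ξ ω) s)) P := fun Γ => by
    refine integrable_finsetSum _ fun j _ => ?_
    refine Integrable.of_bound (Measurable.aestronglyMeasurable ?_) ((∑ i, |Γ i j|) * B)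
      (Eventually.of_forall fun ω => ?_)
    · exact ((measurable_from_top (f := fun i => Γ i j)).comp
        (CadlagPath.measurable_eval s)).mul ((huj j).mono hle le_rfl)
    · rw [norm_mul]
      exact mul_le_mul (Finset.single_le_sum (f := fun i => |Γ i j|)
        (fun i _ => abs_nonneg _) (Finset.mem_univ _)) (hB _ _) (norm_nonneg _) (by positivity)
  set e := NormedSpace.exp (-h • Λ) with he
  -- The position is taken at s, so that its product with the indicator of A is F_s-measurable and
  -- only the index moves.
  have hmarkov : ∫ ω in A, u (ω t) (x + integratedPath (Ξ ω) s) ∂P =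
      ∫ ω in A, ∑ j, e (ω s) j * u j (x + integratedPath (Ξ ω) s) ∂P := by
    have h1 := hP.integral_eval hst
      (V := fun ω j => A.indicator (fun ω => u j (x + integratedPath (Ξ ω) s)) ω)
      (fun j => (huj j).indicator hA) (K := B) (fun ω j => by
        by_cases hω : ω ∈ A
        · simpa [hω] using hB _ _
        · simpa [hω] using hB0)
    rw [← integral_indicator hA', ← integral_indicator hA']
    refine Eq.trans (integral_congr_ae (Eventually.of_forall fun ω => ?_)) (h1.trans
      (integral_congr_ae (Eventually.of_forall fun ω => ?_)))
    · by_cases hω : ω ∈ A <;> simp [hω]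
    · by_cases hω : ω ∈ A <;> simp [hω, he, hh]
  obtain ⟨hJi, hJle⟩ := hP.integral_integral_jump_le hst.le (c := C * h) fun r hsr hrt => by
    have hsr' : (s : ℝ) ≤ r := by exact_mod_cast hsr
    refine (hC r t hrt (by linarith)).trans (mul_le_mul_of_nonneg_left (by linarith) hC0)
  set J : CadlagPath (Fin M) → ℝ := fun ω =>
    ∫ r in (s : ℝ)..t, if ω r.toNNReal = ω t then (0 : ℝ) else 1 with hJ
  set j₀ : CadlagPath (Fin M) → ℝ := fun ω => if ω s = ω t then (0 : ℝ) else 1 with hj₀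
  have hj₀i : Integrable j₀ P :=
    Integrable.of_bound (measurable_jump.comp (measurable_id.prodMk
      (measurable_const (a := (s, t))))).aestronglyMeasurable 1 (Eventually.of_forall fun ω => by
        simp only [hj₀]
        split_ifs <;> simp)
  have hJA : ∫ ω in A, J ω ∂P ≤ C * h * h := by
    refine (setIntegral_le_integral hJi (Eventually.of_forall fun ω => ?_)).trans hJle
    refine intervalIntegral.integral_nonneg (by exact_mod_cast hst.le) fun r _ => ?_
    split_ifs <;> simp
  have hj₀A : ∫ ω in A, j₀ ω ∂P ≤ C * h := by
    refine (setIntegral_le_integral hj₀i (Eventually.of_forall fun ω => ?_)).trans ?_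
    · simp only [hj₀]
      split_ifs <;> simp
    · rw [hP.integral_jump]
      exact hC s t hst.le hlt₁
  have hcost : ∀ p, Measurable fun ω => ∫ r in (0 : ℝ)..(p : ℝ≥0), runningCost H α x ω (Ξ ω) r :=
    fun p => (measurable_integral_runningCost hH α x).comp (hpair.prodMk measurable_const)
  have hZi : ∀ p ≤ T, Integrable (fun ω => costProcess H α u Ξ x ω p) P := fun p hp => by
    refine (hevi p p).add (Integrable.of_bound (hcost p).aestronglyMeasurable
      ((K + |α|) * ((p : ℝ) - (0 : ℝ≥0))) ?_)
    filter_upwards [hR] with ω hω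
    exact abs_integral_runningCost_le x ω (Ξ ω) zero_le (fun q hq => hω q (hq.trans hp)) hK
  have hpath : ∀ᵐ ω ∂P, u (ω t) (x + integratedPath (Ξ ω) s)
      - (u (ω s) (x + integratedPath (Ξ ω) s) -
        h * ∑ j, Λ (ω s) j * u j (x + integratedPath (Ξ ω) s))
      - (2 * K * J ω + h * (2 * D * B) * j₀ ω + h * (D * δ)) ≤
      costProcess H α u Ξ x ω t - costProcess H α u Ξ x ω s := by
    filter_upwards [hR] with ω hω
    have h1 := hu.sub_le_integral_runningCost hH x ω (Ξ ω) hst.le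
      (fun q hq => hω q (hq.trans htT)) hK hB (fun r hsr hrt j => by
        have hrt' : (r : ℝ) ≤ t := by exact_mod_cast hrt
        exact hmod x (Ξ ω) s r hsr (by linarith)
          (fun q hq => hω q (hq.trans (hrt.trans htT))) j)
    have h2 := intervalIntegral.integral_add_adjacent_intervals
      (intervalIntegrable_runningCost hH α x ω (Ξ ω) 0 s)
      (intervalIntegrable_runningCost hH α x ω (Ξ ω) s t)
    simp only [costProcess]
    linarith
  have hΛi := hcoef Λ
  have hei := hcoef e
  have hf1 : Integrable (fun ω : CadlagPath (Fin M) => u (ω s) (x + integratedPath (Ξ ω) s) -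
        h * ∑ j, Λ (ω s) j * u j (x + integratedPath (Ξ ω) s)) P :=
    (hevi s s).sub (hΛi.const_mul h)
  have herr₀ : Integrable (fun ω => 2 * K * J ω + h * (2 * D * B) * j₀ ω) P :=
    (hJi.const_mul _).add (hj₀i.const_mul _)
  have herr : Integrable (fun ω => 2 * K * J ω + h * (2 * D * B) * j₀ ω + h * (D * δ)) P :=
    herr₀.add (integrable_const _)
  have hinc : Integrable (fun ω => u (ω t) (x + integratedPath (Ξ ω) s) -
      (u (ω s) (x + integratedPath (Ξ ω) s) -
        h * ∑ j, Λ (ω s) j * u j (x + integratedPath (Ξ ω) s))) P := (hevi t s).sub hf1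
  -- First-order cancellation: the entries of 1 - hΛ - e are at most δh, and M of them are
  -- multiplied by values of u bounded by B.
  have hgen : ∫ ω in A, (u (ω s) (x + integratedPath (Ξ ω) s) -
        h * ∑ j, Λ (ω s) j * u j (x + integratedPath (Ξ ω) s)) ∂P
      - ∫ ω in A, ∑ j, e (ω s) j * u j (x + integratedPath (Ξ ω) s) ∂P ≤ M * B * δ * h := by
    rw [← integral_sub hf1.integrableOn hei.integrableOn]
    have hbd : ∀ ω ∈ A, ‖u (ω s) (x + integratedPath (Ξ ω) s) -
        h * ∑ j, Λ (ω s) j * u j (x + integratedPath (Ξ ω) s) -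
        ∑ j, e (ω s) j * u j (x + integratedPath (Ξ ω) s)‖ ≤ M * B * δ * h := by
      intro ω _
      have h1 : u (ω s) (x + integratedPath (Ξ ω) s) =
          ∑ j, (1 : Matrix (Fin M) (Fin M) ℝ) (ω s) j * u j (x + integratedPath (Ξ ω) s) := by
        simp [Matrix.one_apply]
      rw [h1, Finset.mul_sum, ← Finset.sum_sub_distrib, ← Finset.sum_sub_distrib]
      calc _ ≤ ∑ j : Fin M, δ * h * B := by
            refine norm_sum_le_of_le _ fun j _ => ?_
            have h2 := hexp h hpos hlt₃ (ω s) j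
            have h3 : (1 : Matrix (Fin M) (Fin M) ℝ) (ω s) j * u j (x + integratedPath (Ξ ω) s) -
                h * (Λ (ω s) j * u j (x + integratedPath (Ξ ω) s)) -
                e (ω s) j * u j (x + integratedPath (Ξ ω) s) =
                -(e (ω s) j - ((1 : Matrix (Fin M) (Fin M) ℝ) (ω s) j - h * Λ (ω s) j)) *
                  u j (x + integratedPath (Ξ ω) s) := by ring
            rw [h3, norm_mul, norm_neg]
            exact mul_le_mul h2 (hB _ _) (norm_nonneg _) (by positivity)
        _ = M * B * δ * h := by
            rw [Finset.sum_const, Finset.card_univ, Fintype.card_fin, nsmul_eq_mul]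
            ring
    have h2 := norm_setIntegral_le_of_norm_le_const (μ := P) (measure_lt_top P A) hbd
    refine (le_abs_self _).trans (h2.trans ?_)
    exact mul_le_of_le_one_right (by positivity) measureReal_le_one
  have herrle : ∫ ω in A, (2 * K * J ω + h * (2 * D * B) * j₀ ω + h * (D * δ)) ∂P ≤
      2 * K * (C * h * h) + h * (2 * D * B) * (C * h) + h * (D * δ) := by
    rw [integral_add herr₀.integrableOn
      (integrable_const _).integrableOn,
      integral_add (hJi.const_mul _).integrableOn (hj₀i.const_mul _).integrableOn,
      integral_const_mul, integral_const_mul, setIntegral_const, smul_eq_mul]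
    have h1 : P.real A * (h * (D * δ)) ≤ h * (D * δ) :=
      mul_le_of_le_one_left (by positivity) measureReal_le_one
    have h2 := mul_le_mul_of_nonneg_left hJA (by positivity : 0 ≤ 2 * K)
    have h3 := mul_le_mul_of_nonneg_left hj₀A (by positivity : 0 ≤ h * (2 * D * B))
    linarith
  have hmono := setIntegral_mono_ae (s := A) (hinc.sub herr).integrableOn
    ((hZi t htT).sub (hZi s (hst.le.trans htT))).integrableOn hpath
  refine le_trans ?_ hmono
  simp only [Pi.sub_apply]
  rw [integral_sub hinc.integrableOn herr.integrableOn,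
    integral_sub (hevi t s).integrableOn hf1.integrableOn, hmarkov]
  have hfin : Q * h ≤ ε / 2 := by
    rw [lt_div_iff₀ (by positivity)] at hlt₄
    linarith
  have h5 : (2 * K * C + 2 * D * B * C) * h ≤ ε / 2 := by
    have : Q * h = (2 * K * C + 2 * D * B * C) * h + h := by
      rw [hQ]
      ring
    linarith
  have h6 := mul_le_mul_of_nonneg_right h5 hpos.le
  have h7 := mul_le_mul_of_nonneg_right hδε hpos.le
  linarith

end Step

/-! ### Integrability and optional sampling for the cost process. -/

section Main

variable {M N : ℕ} {H : Fin M → UnitAddTorus (Fin N) → EuclideanSpace ℝ (Fin N) → ℝ}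
  {Λ : Matrix (Fin M) (Fin M) ℝ} {α : ℝ} {u : Fin M → UnitAddTorus (Fin N) → ℝ} {a : Fin M → ℝ}
  {P : Measure (CadlagPath (Fin M))} {τ : CadlagPath (Fin M) → ℝ≥0}
  {Ξ : CadlagPath (Fin M) → CadlagPath (EuclideanSpace ℝ (Fin N))}

theorem IsBoundedStoppingTime.measurableSet_lt (hτ : IsBoundedStoppingTime τ) (s : ℝ≥0) :
    MeasurableSet[pathFiltration (Fin M) s] {ω | s < τ ω} := by
  have h := (hτ.1 s).compl
  convert h using 1
  ext ω
  change s < τ ω ↔ ¬ ((τ ω : WithTop ℝ≥0) ≤ s)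
  rw [WithTop.coe_le_coe, not_le]

theorem IsBoundedStoppingTime.measurable (hτ : IsBoundedStoppingTime τ) : Measurable τ :=
  measurable_of_Ioi fun s => (pathFiltration (Fin M)).le s _ (hτ.measurableSet_lt s)

theorem IsControl.exists_ae_norm_le (hΞ : IsControl P Ξ) (T : ℝ≥0) :
    ∃ R, ∀ᵐ ω ∂P, ∀ s ≤ T, ‖Ξ ω s‖ ≤ R := by
  obtain ⟨R, hR⟩ := hΞ.locallyBounded (T + 1) (by positivity)
  exact ⟨R, hR.mono fun ω hω s hs => (hω s (hs.trans le_self_add)).le⟩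

theorem IsSubsolution.integrable_stopped (hu : IsSubsolution H Λ α u)
    (hP : IsChainMeasure Λ a P) (hτ : IsBoundedStoppingTime τ) (hΞ : IsControl P Ξ)
    (x : UnitAddTorus (Fin N)) :
    Integrable (fun ω => u (ω (τ ω)) (x + integratedPath (Ξ ω) (τ ω))) P := by
  have := hP.isProbabilityMeasure
  obtain ⟨B, -, hB⟩ := hu.exists_abs_le
  have hm := (measurable_eval_integratedPath hu x).comp
    ((measurable_id.prodMk hΞ.measurable).prodMk (hτ.measurable.prodMk hτ.measurable))
  exact Integrable.of_bound (f := fun ω => u (ω (τ ω)) (x + integratedPath (Ξ ω) (τ ω)))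
    hm.aestronglyMeasurable B (Eventually.of_forall fun ω => hB _ _)

theorem IsSubsolution.integrable_initial (hu : IsSubsolution H Λ α u)
    (hP : IsChainMeasure Λ a P) (x : UnitAddTorus (Fin N)) :
    Integrable (fun ω : CadlagPath (Fin M) => u (ω 0) x) P := by
  have := hP.isProbabilityMeasure
  obtain ⟨B, -, hB⟩ := hu.exists_abs_le
  have hm := (measurable_from_top (f := fun i => u i x)).comp (CadlagPath.measurable_eval 0)
  exact Integrable.of_bound (f := fun ω : CadlagPath (Fin M) => u (ω 0) x)
    hm.aestronglyMeasurable B (Eventually.of_forall fun ω => hB _ _)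

theorem integrable_integral_runningCost (hH : ∀ i, IsHamiltonian (H i))
    (hP : IsChainMeasure Λ a P) (hτ : IsBoundedStoppingTime τ) (hΞ : IsControl P Ξ)
    (x : UnitAddTorus (Fin N)) :
    Integrable (fun ω => ∫ s in (0 : ℝ)..τ ω, runningCost H α x ω (Ξ ω) s) P := by
  have := hP.isProbabilityMeasure
  obtain ⟨T, hT⟩ := hτ.2
  obtain ⟨R, hR⟩ := hΞ.exists_ae_norm_le T
  obtain ⟨K, hK0, hK⟩ := exists_abs_lagrangian_le hH R
  have hm := (measurable_integral_runningCost hH α x).comp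
    ((measurable_id.prodMk hΞ.measurable).prodMk hτ.measurable)
  refine Integrable.of_bound
    (f := fun ω => ∫ s in (0 : ℝ)..τ ω, runningCost H α x ω (Ξ ω) s)
    hm.aestronglyMeasurable ((K + |α|) * T) ?_
  filter_upwards [hR] with ω hω
  refine (abs_integral_runningCost_le x ω (Ξ ω) (s := 0) zero_le
    (fun q hq => hω q (hq.trans (hT ω))) hK).trans ?_
  rw [NNReal.coe_zero, sub_zero]
  exact mul_le_mul_of_nonneg_left (by exact_mod_cast hT ω) (by positivity)

theorem costProcess_continuousWithinAt (hu : IsSubsolution H Λ α u)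
    (hH : ∀ i, IsHamiltonian (H i)) (x : UnitAddTorus (Fin N)) (ω : CadlagPath (Fin M))
    (t : ℝ≥0) : ContinuousWithinAt (costProcess H α u Ξ x ω) (Set.Ici t) t := by
  have h1 : Continuous fun w : Fin M × UnitAddTorus (Fin N) => u w.1 w.2 :=
    continuous_prod_of_discrete_left.2 hu.continuous
  have h2 : ContinuousWithinAt (fun t => (ω t, x + integratedPath (Ξ ω) t)) (Set.Ici t) t :=
    (ω.2.rightContinuous t).prodMk
      (continuous_const.add (continuous_integratedPath (Ξ ω))).continuousWithinAt
  have h3 := (intervalIntegral.continuous_primitive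
    (intervalIntegrable_runningCost hH α x ω (Ξ ω)) 0).comp NNReal.continuous_coe
  exact (h1.continuousAt.comp_continuousWithinAt h2).add h3.continuousWithinAt

theorem measurable_costProcess (hu : IsSubsolution H Λ α u) (hH : ∀ i, IsHamiltonian (H i))
    (hΞ : IsControl P Ξ) (x : UnitAddTorus (Fin N)) :
    Measurable fun z : CadlagPath (Fin M) × ℝ≥0 => costProcess H α u Ξ x z.1 z.2 := by
  have h1 : Measurable fun z : CadlagPath (Fin M) × ℝ≥0 => (z.1, Ξ z.1) :=
    measurable_fst.prodMk (hΞ.measurable.comp measurable_fst)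
  have h2 := (measurable_eval_integratedPath hu x).comp
    (h1.prodMk (measurable_snd.prodMk measurable_snd))
  have h3 := (measurable_integral_runningCost hH α x).comp (h1.prodMk measurable_snd)
  exact h2.add h3

/-- The cost of a nonanticipating control up to a bounded stopping time bounds the expected decrease
of a subsolution. -/
theorem IsSubsolution.integral_sub_le (hu : IsSubsolution H Λ α u) (hH : ∀ i, IsHamiltonian (H i))
    (hP : IsChainMeasure Λ a P) (hτ : IsBoundedStoppingTime τ) (hΞ : IsControl P Ξ)
    (x : UnitAddTorus (Fin N)) :
    ∫ ω, (u (ω 0) x - u (ω (τ ω)) (x + integratedPath (Ξ ω) (τ ω))) ∂P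
      ≤ ∫ ω, (∫ s in (0 : ℝ)..τ ω, runningCost H α x ω (Ξ ω) s) ∂P := by
  have := hP.isProbabilityMeasure
  obtain ⟨T₀, hT₀⟩ := hτ.2
  -- The horizon is T₀ + 1 because optional sampling needs a positive one, and T₀ may be 0.
  obtain ⟨R, hR⟩ := hΞ.exists_ae_norm_le (T₀ + 1)
  obtain ⟨K, hK0, hK⟩ := exists_abs_lagrangian_le hH R
  obtain ⟨B, hB0, hB⟩ := hu.exists_abs_le
  have key := integral_zero_le_integral_stopped (P := P) (pathFiltration (Fin M))
    (Z := costProcess H α u Ξ x) (τ := τ) (T := T₀ + 1)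
    (K := B + (K + |α|) * ((T₀ + 1 : ℝ≥0) : ℝ)) (measurable_costProcess hu hH hΞ x)
    (costProcess_continuousWithinAt hu hH x) (by
      filter_upwards [hR] with ω hω t ht
      refine (abs_add_le _ _).trans (add_le_add (hB _ _) ?_)
      refine (abs_integral_runningCost_le x ω (Ξ ω) (s := 0) zero_le
        (fun q hq => hω q (hq.trans ht)) hK).trans ?_
      rw [NNReal.coe_zero, sub_zero]
      exact mul_le_mul_of_nonneg_left (by exact_mod_cast ht) (by positivity))
    hτ.measurableSet_lt (fun ω => (hT₀ ω).trans le_self_add) (by positivity)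
    (fun ε hε => hu.neg_le_setIntegral_costProcess hH hP hΞ x hR hε)
  have h0 : ∀ ω, costProcess H α u Ξ x ω 0 = u (ω 0) x := fun ω => by
    have : proj (0 : EuclideanSpace ℝ (Fin N)) = 0 := funext fun k => by simp [proj]
    simp [costProcess, integratedPath, this]
  simp only [h0] at key
  have hs := hu.integrable_stopped hP hτ hΞ x
  have hc := integrable_integral_runningCost (α := α) hH hP hτ hΞ x
  have hadd := integral_add hs hc
  rw [integral_sub (hu.integrable_initial hP x) hs]
  change _ ≤ ∫ ω, (u (ω (τ ω)) (x + integratedPath (Ξ ω) (τ ω)) +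
    ∫ r in (0 : ℝ)..τ ω, runningCost H α x ω (Ξ ω) r) ∂P at key
  linarith

end Main

end HJSystem

end

theorem theorem4p1 {M N : ℕ}
    (H : Fin M → UnitAddTorus (Fin N) → EuclideanSpace ℝ (Fin N) → ℝ)
    (hH : ∀ i, HJSystem.IsHamiltonian (H i))
    (Λ : Matrix (Fin M) (Fin M) ℝ) (hΛ : HJSystem.IsCouplingMatrix Λ)
    (α : ℝ) (hα : HJSystem.criticalValue H Λ ≤ α)
    (u : Fin M → UnitAddTorus (Fin N) → ℝ) (hu : HJSystem.IsSubsolution H Λ α u)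
    (a : Fin M → ℝ) (ha : a ∈ stdSimplex ℝ (Fin M))
    (P : Measure (HJSystem.CadlagPath (Fin M))) (hP : HJSystem.IsChainMeasure Λ a P)
    (τ : HJSystem.CadlagPath (Fin M) → ℝ≥0) (hτ : HJSystem.IsBoundedStoppingTime τ)
    (Ξ : HJSystem.CadlagPath (Fin M) → HJSystem.CadlagPath (EuclideanSpace ℝ (Fin N)))
    (hΞ : HJSystem.IsControl P Ξ)
    (x : UnitAddTorus (Fin N)) :
    Integrable (fun ω => u (ω 0) x - u (ω (τ ω)) (x + HJSystem.integratedPath (Ξ ω) (τ ω))) P ∧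
    (∀ ω, IntervalIntegrable (HJSystem.runningCost H α x ω (Ξ ω)) volume 0 (τ ω)) ∧
    Integrable (fun ω => ∫ s in (0 : ℝ)..τ ω, HJSystem.runningCost H α x ω (Ξ ω) s) P ∧
    (∫ ω, (u (ω 0) x - u (ω (τ ω)) (x + HJSystem.integratedPath (Ξ ω) (τ ω))) ∂P
      ≤ ∫ ω, (∫ s in (0 : ℝ)..τ ω, HJSystem.runningCost H α x ω (Ξ ω) s) ∂P) ∧
    (∀ y : UnitAddTorus (Fin N),
      (∀ᵐ ω ∂P, HJSystem.integratedPath (Ξ ω) (τ ω) = y - x) →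
      ∫ ω, (u (ω 0) x - u (ω (τ ω)) y) ∂P
        ≤ ∫ ω, (∫ s in (0 : ℝ)..τ ω, HJSystem.runningCost H α x ω (Ξ ω) s) ∂P) := by
  have hs := hu.integrable_stopped hP hτ hΞ x
  have hmain := hu.integral_sub_le hH hP hτ hΞ x
  refine ⟨(hu.integrable_initial hP x).sub hs,
    fun ω => HJSystem.intervalIntegrable_runningCost hH α x ω (Ξ ω) 0 (τ ω),
    HJSystem.integrable_integral_runningCost hH hP hτ hΞ x, hmain, fun y hy => ?_⟩
  refine le_trans (le_of_eq (integral_congr_ae ?_)) hmain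
  filter_upwards [hy] with ω hω
  rw [hω, add_sub_cancel]
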